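/- Let $N,K\ge 0$ and $m\ge 0$ be integers, let $A=(a_{ij})\in\mathbb R^{K\times K}$ and $b=(b_1,\dots,b_K)\in\mathbb R^K$. **Trees.** A labelled tree is a pair $(V,E)$ consisting of a finite nonempty set $V\subset\mathbb Z$ of vertices and a set $E\subset\{(x,y)\in V\times V: x<y\}$ of edges such that every vertex $y$ has at most one $x$ with $(x,y)\in E$, and for any two distinct vertices $x,y$ there is a directed path from $x$ to $y$, or from $y$ to $x$, or there is a third vertex from which there are directed paths to both. Let $T$ be the set of isomorphism classes of labelled trees, that is, of finite rooted trees. Let $\tau$ be the tree with one vertex, and for $l\ge 1$ let $[t_1\cdots t_l]$ be the tree obtained by joining a new root to the roots of $t_1,\dots,t_l$ (the order of the $t_k$ is irrelevant); $\tau$ is regarded as the case $l=0$. For $t\in T$ let $r(t)$ be its number of vertices, let $\alpha(t)$ be the number of labelled trees with vertex set $\{1,\dots,r(t)\}$ in the class $t$, and put $\sigma(\tau)=1$ and $$\sigma([t_1^{m_1}\cdots t_l^{m_l}])=\prod_{i=1}^l m_i!\,\sigma(t_i)^{m_i}$$ for pairwise distinct $t_1,\dots,t_l$ occurring with multiplicities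 $m_1,\dots,m_l$. For $i=1,\dots,K$ put $$\zeta_i([t_1\cdots t_l];A)=\sum_{j=1}^K a_{ij}\prod_{k=1}^l\zeta_j(t_k;A),$$ where an empty product is $1$, so that $\zeta_i(\tau;A)=\sum_{j=1}^K a_{ij}$. **Order conditions.** $(A,b)$ satisfies the $m$-th order conditions if $$\frac{\alpha(t)}{r(t)!}=\frac{\sum_{i=1}^K b_i\prod_{k=1}^l\zeta_i(t_k;A)}{\sigma(t)}$$ for every $t=[t_1\cdots t_l]\in T$, $l\ge 0$, with $r(t)\le m$. **Integration schemes.** Let $C_b^\infty(\mathbb R^N;\mathbb R^N)$ be the set of smooth maps that are bounded together with all their derivatives. For $W$ in this set, let $\exp(W)(x)$ be the value at time $1$ of the solution of $\frac{dz_t}{dt}=W(z_t)$, $z_0=x$, and let $$\|W\|_{C^n}=\sum_{i=0}^n\sup\{|W^{(i)}_{(x)}(U_1,\dots,U_i)| : x\in\mathbb R^N,\ |U_1|=\dots=|U_i|=1\},$$ where $W^{(i)}$ is the $i$-th total differential of $W$. A map $g$ from $C_b^\infty(\mathbb R^N;\mathbb R^N)$ to the set of maps $\mathbb R^N\to\mathbb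 R^N$ is an integration scheme of order $m$ if there is a constant $C>0$ such that $$\sup_{x\in\mathbb R^N}|g(W)(x)-\exp(W)(x)|\le C\,\|W\|_{C^{m+1}}^{m+1}\quad\text{for all } W\in C_b^\infty(\mathbb R^N;\mathbb R^N).$$ **Theorem.** Suppose that $(A,b)$ satisfies the $m$-th order conditions. Let $g(W)(y_0)=Y(y_0;W,1)$ be given by the Runge–Kutta method with coefficients $(A,b)$ and step $s=1$, that is, for all $W\in C_b^\infty(\mathbb R^N;\mathbb R^N)$ and $y_0\in\mathbb R^N$, $$g(W)(y_0)=y_0+\sum_{i=1}^K b_iW(Y_i)\quad\text{for some } Y_1,\dots,Y_K\in\mathbb R^N \text{ with } Y_i=y_0+\sum_{j=1}^K a_{ij}W(Y_j),\quad i=1,\dots,K$$ (if the method is implicit and this system has several solutions, any choice of a solution is allowed). Then $g$ is an integration scheme of order $m$. -/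

import Mathlib

open scoped ContDiff Nat

noncomputable section

namespace RK

/-! ### Unlabelled rooted trees -/

/-- `Multiset` is a quotient of the polynomial functor `X ↦ Σ n, Xⁿ`. -/
instance multisetQPF : QPF Multiset where
  toFunctor := Multiset.functor
  P := ⟨ℕ, Fin⟩
  abs := fun p => (List.ofFn p.2 : Multiset _)
  repr := fun s => ⟨s.toList.length, s.toList.get⟩
  abs_repr := fun s => by
    change ((List.ofFn s.toList.get : List _) : Multiset _) = s
    rw [List.ofFn_get, Multiset.coe_toList]
  abs_map := fun f p => by
    obtain ⟨n, x⟩ := p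
    change ((List.ofFn (f ∘ x) : List _) : Multiset _) = Multiset.map f (List.ofFn x : List _)
    rw [Multiset.map_coe, List.map_ofFn]

/-- The set `T` of unlabelled (finite) rooted trees, i.e. the least type closed under forming a tree
`[t₁ ⋯ tₗ]` from a finite multiset of trees `t₁, …, tₗ` (`l = 0` gives the one-vertex tree `τ`). -/
def RTree : Type := QPF.Fix Multiset

namespace RTree

/-- The tree `[t₁ ⋯ tₗ]`: a new root joined to the roots of `t₁, …, tₗ`. -/
def node (s : Multiset RTree) : RTree := QPF.Fix.mk s

/-- The multiset `t₁, …, tₗ` of branches of `t = [t₁ ⋯ tₗ]`. -/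
def branches (t : RTree) : Multiset RTree := QPF.Fix.dest t

/-- Recursion on rooted trees. -/
def fold {α : Type} (g : Multiset α → α) (t : RTree) : α := QPF.Fix.rec g t

theorem branches_node (s : Multiset RTree) : (node s).branches = s := QPF.Fix.dest_mk s

theorem node_branches (t : RTree) : node t.branches = t := QPF.Fix.mk_dest t

theorem fold_node {α : Type} (g : Multiset α → α) (s : Multiset RTree) :
    fold g (node s) = g (s.map (fold g)) := QPF.Fix.rec_eq g s

theorem induction {p : RTree → Prop} (h : ∀ s : Multiset RTree, (∀ t ∈ s, p t) → p (node s))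
    (t : RTree) : p t := by
  refine QPF.Fix.ind p (fun s hs => h s ?_) t
  obtain ⟨u, rfl⟩ := hs
  intro t ht
  obtain ⟨a, -, rfl⟩ := Multiset.mem_map.1 ht
  exact a.2

/-- The number `r(t)` of vertices. -/
def order (t : RTree) : ℕ := fold (fun s => 1 + s.sum) t

theorem order_node (s : Multiset RTree) : (node s).order = 1 + (s.map order).sum :=
  fold_node _ s

open Classical in
/-- Recursion for `t ↦ (t, σ(t))`. -/
def symmetryAux (t : RTree) : RTree × ℕ :=
  fold (fun s : Multiset (RTree × ℕ) =>
    (node (s.map Prod.fst), ∏ p ∈ s.toFinset, (s.count p)! * p.2 ^ s.count p)) t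

/-- The symmetry `σ(t)`; see `symmetry_node` for its recursion. -/
def symmetry (t : RTree) : ℕ := (symmetryAux t).2

theorem symmetryAux_fst (t : RTree) : (symmetryAux t).1 = t := by
  refine induction (p := fun t => (symmetryAux t).1 = t) (fun s hs => ?_) t
  rw [symmetryAux, fold_node]
  simp only [Multiset.map_map, Function.comp_def]
  congr 1
  exact (Multiset.map_congr rfl hs).trans (Multiset.map_id _)

open Classical in
/-- `σ([t₁^{m₁} ⋯ tₗ^{mₗ}]) = ∏ mᵢ! σ(tᵢ)^{mᵢ}` for pairwise distinct `t₁, …, tₗ`. -/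
theorem symmetry_node (s : Multiset RTree) :
    (node s).symmetry = ∏ t ∈ s.toFinset, (s.count t)! * t.symmetry ^ s.count t := by
  have hinj : Function.Injective symmetryAux := fun a b h => by
    rw [← symmetryAux_fst a, ← symmetryAux_fst b, h]
  have h : (node s).symmetry = ∏ p ∈ (s.map symmetryAux).toFinset,
      ((s.map symmetryAux).count p)! * p.2 ^ (s.map symmetryAux).count p := by
    rw [symmetry, symmetryAux, fold_node]
    rfl
  rw [h, Multiset.toFinset_map, Finset.prod_image (fun a _ b _ hab => hinj hab)]
  refine Finset.prod_congr rfl fun t _ => ?_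
  rw [Multiset.count_map_eq_count' _ _ hinj]
  rfl

/-- The derivative weights `ζᵢ(t; A)`; see `weight_node` for their recursion. -/
def weight {K : ℕ} (A : Matrix (Fin K) (Fin K) ℝ) (t : RTree) : Fin K → ℝ :=
  fold (fun s : Multiset (Fin K → ℝ) => fun i => ∑ j, A i j * (s.map fun z => z j).prod) t

/-- `ζᵢ([t₁ ⋯ tₗ]; A) = ∑ⱼ aᵢⱼ ∏ₖ ζⱼ(tₖ; A)`. -/
theorem weight_node {K : ℕ} (A : Matrix (Fin K) (Fin K) ℝ) (s : Multiset RTree) (i : Fin K) :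
    weight A (node s) i = ∑ j, A i j * (s.map fun t => weight A t j).prod := by
  rw [weight, fold_node]
  simp only [Multiset.map_map, Function.comp_def]
  rfl

end RTree

/-! ### Labelled trees -/

/-- A labelled tree: a finite nonempty set of integers as vertices, and edges that increase. -/
structure LTree where
  V : Finset ℤ
  E : Finset (ℤ × ℤ)
  nonempty : V.Nonempty
  edge_mem : ∀ e ∈ E, e.1 ∈ V ∧ e.2 ∈ V ∧ e.1 < e.2
  parent_unique : ∀ x x' y : ℤ, (x, y) ∈ E → (x', y) ∈ E → x = x'
  connected : ∀ x ∈ V, ∀ y ∈ V, x ≠ y →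
    Relation.TransGen (fun a b => (a, b) ∈ E) x y ∨
    Relation.TransGen (fun a b => (a, b) ∈ E) y x ∨
    ∃ z ∈ V, z ≠ x ∧ z ≠ y ∧ Relation.TransGen (fun a b => (a, b) ∈ E) z x ∧
      Relation.TransGen (fun a b => (a, b) ∈ E) z y

namespace LTree

/-- The children of a vertex. -/
def children (u : LTree) (x : ℤ) : Finset ℤ := u.V.filter fun y => (x, y) ∈ u.E

/-- The unlabelled rooted tree formed by `x` and the vertices that can be reached from `x`. -/
def shapeAt (u : LTree) (x : ℤ) : RTree :=
  RTree.node ((u.children x).attach.val.map fun y => shapeAt u y.1)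
termination_by (u.V.filter fun z => x < z).card
decreasing_by
  have hy := Finset.mem_filter.1 y.2
  have hlt : x < y.1 := (u.edge_mem _ hy.2).2.2
  refine Finset.card_lt_card (Finset.ssubset_iff_subset_ne.2 ⟨fun z hz => ?_, fun h => ?_⟩)
  · rw [Finset.mem_filter] at hz ⊢
    exact ⟨hz.1, hlt.trans hz.2⟩
  · have hmem : y.1 ∈ u.V.filter fun z => x < z := Finset.mem_filter.2 ⟨hy.1, hlt⟩
    rw [← h] at hmem
    exact lt_irrefl _ (Finset.mem_filter.1 hmem).2

/-- The root; since edges increase, it is the least vertex. -/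
def root (u : LTree) : ℤ := u.V.min' u.nonempty

/-- The unlabelled tree `|u|` that a labelled tree `u` represents. -/
def shape (u : LTree) : RTree := u.shapeAt u.root

end LTree

/-- `α(t)`: the number of labelled trees with vertex set `{1, …, r(t)}` that represent `t`. -/
def RTree.labellings (t : RTree) : ℕ :=
  Nat.card {u : LTree // u.V = Finset.Icc 1 (t.order : ℤ) ∧ u.shape = t}

/-- The `m`-th order conditions on the Runge–Kutta coefficients `(A, b)`. -/
def OrderConditions {K : ℕ} (m : ℕ) (A : Matrix (Fin K) (Fin K) ℝ) (b : Fin K → ℝ) : Prop :=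
  ∀ t : RTree, t.order ≤ m →
    (t.labellings : ℝ) / (t.order ! : ℝ) =
      (∑ i, b i * (t.branches.map fun s => s.weight A i).prod) / (t.symmetry : ℝ)

/-! ### Vector fields, flows and integration schemes -/

/-- `C_b^∞(ℝ^N; ℝ^N)`: smooth maps all of whose derivatives (of order `≥ 0`) are bounded. -/
structure SmoothBdd (N : ℕ) where
  toFun : EuclideanSpace ℝ (Fin N) → EuclideanSpace ℝ (Fin N)
  contDiff : ContDiff ℝ ∞ toFun
  bounded : ∀ n : ℕ, ∃ C : ℝ, ∀ x, ‖iteratedFDeriv ℝ n toFun x‖ ≤ C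

instance {N : ℕ} : CoeFun (SmoothBdd N)
    (fun _ => EuclideanSpace ℝ (Fin N) → EuclideanSpace ℝ (Fin N)) := ⟨SmoothBdd.toFun⟩

namespace SmoothBdd

variable {N : ℕ}

/-- `‖W^{(n)}‖`. -/
def derivNorm (W : SmoothBdd N) (n : ℕ) : ℝ :=
  sSup {c : ℝ | ∃ (x : EuclideanSpace ℝ (Fin N)) (U : Fin n → EuclideanSpace ℝ (Fin N)),
    (∀ i, ‖U i‖ = 1) ∧ c = ‖iteratedFDeriv ℝ n W x U‖}

/-- `‖W‖_{C^n}`. -/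
def cNorm (W : SmoothBdd N) (n : ℕ) : ℝ := ∑ i ∈ Finset.range (n + 1), W.derivNorm i

/-- `z` solves `dz/dt = W(z)`, `z(0) = x` on `[0, 1]`. -/
def IsSolution (W : SmoothBdd N) (x : EuclideanSpace ℝ (Fin N))
    (z : ℝ → EuclideanSpace ℝ (Fin N)) : Prop :=
  z 0 = x ∧ ∀ t ∈ Set.Icc (0 : ℝ) 1, HasDerivWithinAt z (W (z t)) (Set.Icc 0 1) t

theorem exists_lipschitz (W : SmoothBdd N) : ∃ L : NNReal, LipschitzWith L W := by
  obtain ⟨C, hC⟩ := W.bounded 1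
  refine ⟨C.toNNReal, lipschitzWith_of_nnnorm_fderiv_le
    (W.contDiff.differentiable (by simp)) fun x => ?_⟩
  rw [← NNReal.coe_le_coe, coe_nnnorm, ← norm_iteratedFDeriv_one]
  exact (hC x).trans (Real.le_coe_toNNReal C)

theorem exists_solution (W : SmoothBdd N) (x : EuclideanSpace ℝ (Fin N)) :
    ∃ z, W.IsSolution x z := by
  obtain ⟨C, hC⟩ := W.bounded 0
  obtain ⟨L, hL⟩ := W.exists_lipschitz
  have h : IsPicardLindelof (fun _ : ℝ => W.toFun)
      (⟨0, by simp⟩ : Set.Icc (0 : ℝ) 1) x C.toNNReal 0 C.toNNReal L :=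
    { lipschitzOnWith := fun _ _ => hL.lipschitzOnWith
      continuousOn := fun _ _ => continuousOn_const
      norm_le := fun _ _ y _ => by
        have := hC y
        rw [norm_iteratedFDeriv_zero] at this
        exact this.trans (Real.le_coe_toNNReal C)
      mul_max_le := by simp }
  exact h.exists_eq_forall_mem_Icc_hasDerivWithinAt₀

theorem IsSolution.unique {W : SmoothBdd N} {x : EuclideanSpace ℝ (Fin N)}
    {z z' : ℝ → EuclideanSpace ℝ (Fin N)} (h : W.IsSolution x z) (h' : W.IsSolution x z') :
    z 1 = z' 1 := by
  obtain ⟨L, hL⟩ := W.exists_lipschitz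
  have key : ∀ {z : ℝ → EuclideanSpace ℝ (Fin N)}, W.IsSolution x z →
      ContinuousOn z (Set.Icc 0 1) ∧
        ∀ t ∈ Set.Ico (0 : ℝ) 1, HasDerivWithinAt z (W (z t)) (Set.Ici t) t := fun hz =>
    ⟨fun t ht => (hz.2 t ht).continuousWithinAt, fun t ht =>
      (hz.2 t (Set.Ico_subset_Icc_self ht)).mono_of_mem_nhdsWithin
        (Icc_mem_nhdsGE_of_mem ht)⟩
  exact ODE_solution_unique_of_mem_Icc_right (v := fun _ => W.toFun) (s := fun _ => Set.univ)
    (fun _ _ => hL.lipschitzOnWith) (key h).1 (key h).2 (fun _ _ => trivial)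
    (key h').1 (key h').2 (fun _ _ => trivial) (h.1.trans h'.1.symm) (by simp)

/-- `exp(W)(x)`: the value at time `1` of the solution of `dz/dt = W(z)`, `z(0) = x`. -/
def exp (W : SmoothBdd N) (x : EuclideanSpace ℝ (Fin N)) : EuclideanSpace ℝ (Fin N) :=
  (W.exists_solution x).choose 1

theorem IsSolution.eq_exp {W : SmoothBdd N} {x : EuclideanSpace ℝ (Fin N)}
    {z : ℝ → EuclideanSpace ℝ (Fin N)} (h : W.IsSolution x z) : z 1 = W.exp x :=
  h.unique (W.exists_solution x).choose_spec

end SmoothBdd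

/-- `g` is an integration scheme of order `m`. -/
def IsIntegrationScheme {N : ℕ} (m : ℕ)
    (g : SmoothBdd N → EuclideanSpace ℝ (Fin N) → EuclideanSpace ℝ (Fin N)) : Prop :=
  ∃ C : ℝ, 0 < C ∧ ∀ (W : SmoothBdd N) (x : EuclideanSpace ℝ (Fin N)),
    ‖g W x - W.exp x‖ ≤ C * W.cNorm (m + 1) ^ (m + 1)

/-- `y` is a value `Y(y₀; W, s)` of the Runge–Kutta method `(A, b)`: for some solution `Y₁, …, Y_K`
of the (in general implicit) stage equations `Yᵢ = y₀ + s ∑ⱼ aᵢⱼ W(Yⱼ)`, one has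
`y = y₀ + s ∑ᵢ bᵢ W(Yᵢ)`. -/
def IsRungeKuttaValue {N K : ℕ} (A : Matrix (Fin K) (Fin K) ℝ) (b : Fin K → ℝ) (W : SmoothBdd N)
    (s : ℝ) (y₀ y : EuclideanSpace ℝ (Fin N)) : Prop :=
  ∃ Y : Fin K → EuclideanSpace ℝ (Fin N),
    (∀ i, Y i = y₀ + s • ∑ j, A i j • W (Y j)) ∧ y = y₀ + s • ∑ i, b i • W (Y i)

end RK

end

/-!
Both the flow of `W` and the Runge–Kutta step are expanded in elementary differentials `F_W(t)`,
`t ∈ T`, where `F_W([t₁ ⋯ tₗ]) = W⁽ˡ⁾(F_W(t₁), …, F_W(tₗ))`; if the derivatives of `W` are bounded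
by `M`, then `F_W(t)` has size at most `M ^ r(t)`.

By the chain rule, the derivative of `F_W(t)` along an integral curve is the sum over all ways of
attaching a leaf to `t`. Giving the new leaf the largest label, one sees that the `n`-th derivative
of an integral curve is the sum of `F_W(|u|)` over the labelled trees `u` on `{1, …, n}`, so that
the coefficient of `F_W(t)` in Taylor's formula for the flow is `α(t) / r(t)!`.

Substituting a B-series into Taylor's formula for `W` and collecting the tuples of trees with the
same underlying multiset, whose number produces `σ`, gives again a B-series. By induction on the
order, which needs no solution theory for the stage equations, the stages are B-series with
coefficients `ζᵢ`. The order conditions say that the two expansions agree up to order `m`, and all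
errors are `O(M ^ (m + 1))` uniformly as long as `M ≤ 1`. For `M ≥ 1` the trivial bound `O(M)`
suffices.
-/

noncomputable section

namespace RK

/-! ### Tuples with a prescribed multiset of values -/

section Tuples

variable {α : Type*} {k : ℕ}

theorem exists_map_univ_eq {s : Multiset α} (hs : s.card = k) :
    ∃ f : Fin k → α, Finset.univ.val.map f = s := by
  subst hs
  obtain ⟨l, rfl⟩ : ∃ l : List α, ↑l = s := Quot.exists_rep s
  exact ⟨l.get, (Fin.univ_val_map l.get).trans (congrArg _ (List.ofFn_get l))⟩

theorem map_univ_comp_perm (f : Fin k → α) (σ : Equiv.Perm (Fin k)) :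
    Finset.univ.val.map (f ∘ σ) = Finset.univ.val.map f := by
  rw [Fin.univ_val_map, Fin.univ_val_map]
  exact Quotient.sound (σ.ofFn_comp_perm f)

theorem count_map_univ [DecidableEq α] (f : Fin k → α) (a : α) :
    (Finset.univ.val.map f).count a = Fintype.card {i // f i = a} := by
  rw [Multiset.count_map, Fintype.card_subtype]
  simp only [Finset.card_def, Finset.filter_val, eq_comm]

theorem exists_comp_perm_eq {f g : Fin k → α}
    (h : Finset.univ.val.map f = Finset.univ.val.map g) :
    ∃ σ : Equiv.Perm (Fin k), g ∘ σ = f := by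
  have := Classical.decEq α
  have hcard (a : α) : Fintype.card {i // f i = a} = Fintype.card {i // g i = a} := by
    rw [← count_map_univ, h, count_map_univ]
  exact ⟨Equiv.ofFiberEquiv fun a => Fintype.equivOfCardEq (hcard a),
    funext fun i => Equiv.ofFiberEquiv_map _ i⟩

theorem orbit_domMulAct_eq (f : Fin k → α) :
    MulAction.orbit (Equiv.Perm (Fin k))ᵈᵐᵃ f =
      {g | Finset.univ.val.map g = Finset.univ.val.map f} := by
  ext g
  constructor
  · rintro ⟨σ, rfl⟩
    exact map_univ_comp_perm f (DomMulAct.mk.symm σ)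
  · intro h
    obtain ⟨σ, rfl⟩ := exists_comp_perm_eq h
    exact ⟨DomMulAct.mk σ, rfl⟩

theorem card_stabilizer_domMulAct [DecidableEq α] (f : Fin k → α) :
    Nat.card (MulAction.stabilizer (Equiv.Perm (Fin k))ᵈᵐᵃ f) =
      ∏ a ∈ (Finset.univ.val.map f).toFinset, ((Finset.univ.val.map f).count a)! := by
  simp only [count_map_univ]
  rw [← Finset.image, ← DomMulAct.stabilizer_card', ← Nat.card_eq_fintype_card]
  exact Nat.card_congr (DomMulAct.mk.subtypeEquiv fun _ => Iff.rfl).symm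

theorem ncard_tuples_mul_prod_factorial [DecidableEq α] {s : Multiset α} (hs : s.card = k) :
    {f : Fin k → α | Finset.univ.val.map f = s}.ncard * ∏ a ∈ s.toFinset, (s.count a)! = k ! := by
  obtain ⟨f, rfl⟩ := exists_map_univ_eq hs
  rw [← orbit_domMulAct_eq, ← MulAction.index_stabilizer, ← card_stabilizer_domMulAct,
    Subgroup.index_mul_card, Nat.card_congr DomMulAct.mk.symm, Nat.card_eq_fintype_card,
    Fintype.card_perm, Fintype.card_fin]

end Tuples

namespace RTree

/-! ### Trees of bounded order -/

theorem order_eq (t : RTree) : t.order = 1 + (t.branches.map order).sum := by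
  conv_lhs => rw [← node_branches t]
  exact order_node _

theorem order_pos (t : RTree) : 0 < t.order := by
  rw [order_eq]
  omega

theorem order_lt_of_mem_branches {t t' : RTree} (h : t' ∈ t.branches) : t'.order < t.order := by
  rw [order_eq t]
  have := Multiset.single_le_sum (fun _ _ => Nat.zero_le _) _ (Multiset.mem_map_of_mem order h)
  omega

theorem card_branches_lt_order (t : RTree) : t.branches.card < t.order := by
  have := Multiset.card_nsmul_le_sum (s := t.branches.map order) (a := 1)
    (Multiset.forall_mem_map_iff.2 fun t' _ => t'.order_pos)
  rw [Multiset.card_map, smul_eq_mul, mul_one] at this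
  rw [order_eq t]
  omega

theorem finite_order_le (n : ℕ) : {t : RTree | t.order ≤ n}.Finite := by
  classical
  induction n with
  | zero => exact Set.Finite.subset Set.finite_empty fun t ht => t.order_pos.not_ge ht
  | succ n ih =>
    refine ((Set.finite_Iic (n • ih.toFinset.val)).image node).subset fun t ht =>
      ⟨t.branches, Multiset.le_iff_count.2 fun t' => ?_, node_branches t⟩
    have ht : t.order ≤ n + 1 := ht
    by_cases h : t' ∈ t.branches
    · have hmem : t' ∈ ih.toFinset :=
        ih.mem_toFinset.2 (Nat.lt_succ_iff.1 ((order_lt_of_mem_branches h).trans_le ht))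
      rw [Multiset.count_nsmul, Multiset.count_eq_one_of_mem ih.toFinset.nodup hmem, mul_one]
      exact (Multiset.count_le_card _ _).trans
        (Nat.lt_succ_iff.1 (t.card_branches_lt_order.trans_le ht))
    · rw [Multiset.count_eq_zero_of_notMem h]
      exact Nat.zero_le _

/-- The trees with at most `n` vertices, over which the expansions of order `n` are summed. -/
def upTo (n : ℕ) : Finset RTree := (finite_order_le n).toFinset

theorem mem_upTo {n : ℕ} {t : RTree} : t ∈ upTo n ↔ t.order ≤ n := by
  simp [upTo]

theorem upTo_zero : upTo 0 = ∅ :=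
  Finset.eq_empty_of_forall_notMem fun t ht => t.order_pos.not_ge (mem_upTo.1 ht)

theorem symmetry_eq [DecidableEq RTree] (t : RTree) : t.symmetry =
    (∏ t' ∈ t.branches.toFinset, (t.branches.count t')!) * (t.branches.map symmetry).prod := by
  conv_lhs => rw [← node_branches t]
  rw [symmetry_node, Finset.prod_multiset_map_count, ← Finset.prod_mul_distrib]
  convert rfl

theorem weight_eq {K : ℕ} (A : Matrix (Fin K) (Fin K) ℝ) (t : RTree) (i : Fin K) :
    t.weight A i = ∑ j, A i j * (t.branches.map fun t' => t'.weight A j).prod := by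
  conv_lhs => rw [← node_branches t]
  exact weight_node A _ i

end RTree

/-! ### Iterated derivatives in the directions of a multiset -/

section MultiDeriv

variable {E F : Type*} [NormedAddCommGroup E] [NormedSpace ℝ E]
  [NormedAddCommGroup F] [NormedSpace ℝ F] {W : E → F}

/-- The iterated directional derivative of `W` along the constant directions of a list. -/
def dirDeriv (W : E → F) : List E → E → F
  | [] => W
  | v :: l => fun y => fderiv ℝ (dirDeriv W l) y v

theorem contDiff_dirDeriv {l : List E} {n : ℕ} (hW : ContDiff ℝ (n + l.length : ℕ) W) :
    ContDiff ℝ n (dirDeriv W l) := by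
  induction l generalizing n with
  | nil => exact hW
  | cons v l ih =>
    have hl : ContDiff ℝ (n + 1 : ℕ) (dirDeriv W l) :=
      ih (by rwa [List.length_cons, ← add_assoc, add_right_comm] at hW)
    exact (hl.fderiv_right (by norm_cast)).clm_apply contDiff_const

theorem dirDeriv_swap {l : List E} (hW : ContDiff ℝ (l.length + 2 : ℕ) W) (v w : E) :
    dirDeriv W (v :: w :: l) = dirDeriv W (w :: v :: l) := by
  funext y
  have hl : ContDiff ℝ 2 (dirDeriv W l) := contDiff_dirDeriv (by rwa [add_comm])
  have hd : DifferentiableAt ℝ (fderiv ℝ (dirDeriv W l)) y :=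
    (hl.fderiv_right (m := 1) one_add_one_eq_two.le).differentiable one_ne_zero y
  have second_deriv (a b : E) :
      dirDeriv W (a :: b :: l) y = fderiv ℝ (fderiv ℝ (dirDeriv W l)) y a b := by
    simp only [dirDeriv]
    rw [fderiv_clm_apply hd (differentiableAt_const b)]
    simp
  have hsymm : IsSymmSndFDerivAt ℝ (dirDeriv W l) y :=
    hl.contDiffAt.isSymmSndFDerivAt minSmoothness_of_isRCLikeNormedField.le
  rw [second_deriv, second_deriv, hsymm.eq]

theorem dirDeriv_perm {l l' : List E} (hW : ContDiff ℝ l.length W) (h : l.Perm l') :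
    dirDeriv W l = dirDeriv W l' := by
  induction h with
  | nil => rfl
  | cons v _ ih => simp only [dirDeriv, ih (hW.of_le (by simp))]
  | trans h _ ih ih' => exact (ih hW).trans (ih' (h.length_eq ▸ hW))
  | swap v w l => exact dirDeriv_swap hW w v

theorem dirDeriv_ofFn {k : ℕ} (hW : ContDiff ℝ k W) (v : Fin k → E) (y : E) :
    dirDeriv W (List.ofFn v) y = iteratedFDeriv ℝ k W y v := by
  induction k generalizing y with
  | zero => simp [dirDeriv]
  | succ k ih =>
    have hd : DifferentiableAt ℝ (iteratedFDeriv ℝ k W) y :=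
      hW.differentiable_iteratedFDeriv (by norm_cast; omega) y
    rw [List.ofFn_succ, dirDeriv, funext (ih (hW.of_le (by norm_cast; omega)) fun i => v i.succ),
      hd.iteratedFDeriv_succ_apply_left']
    rfl

/-- The iterated derivative `W⁽ˡ⁾(y)(v₁, …, vₗ)` as a function of the multiset `{v₁, …, vₗ}`, on
which it depends only if `W` is `l` times continuously differentiable. -/
def multiDeriv (W : E → F) (y : E) (s : Multiset E) : F := dirDeriv W s.toList y

theorem multiDeriv_coe {l : List E} (hW : ContDiff ℝ l.length W) (y : E) :
    multiDeriv W y l = dirDeriv W l y := by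
  have hperm : (l : Multiset E).toList.Perm l := Multiset.coe_eq_coe.1 (Multiset.coe_toList _)
  rw [multiDeriv, dirDeriv_perm (hperm.length_eq ▸ hW) hperm]

theorem multiDeriv_map_univ {k : ℕ} (hW : ContDiff ℝ k W) (y : E) (v : Fin k → E) :
    multiDeriv W y (Finset.univ.val.map v) = iteratedFDeriv ℝ k W y v := by
  rw [Fin.univ_val_map, multiDeriv_coe (by rwa [List.length_ofFn]), dirDeriv_ofFn hW]

theorem multiDeriv_zero (W : E → F) (y : E) : multiDeriv W y 0 = W y := by
  simp [multiDeriv, dirDeriv]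

theorem multiDeriv_cons {s : Multiset E} (hW : ContDiff ℝ (s.card + 1 : ℕ) W) (y v : E) :
    multiDeriv W y (v ::ₘ s) = fderiv ℝ (fun z => multiDeriv W z s) y v := by
  obtain ⟨l, rfl⟩ : ∃ l : List E, ↑l = s := Quot.exists_rep s
  rw [Multiset.cons_coe, multiDeriv_coe (l := v :: l) hW, dirDeriv,
    funext fun z => multiDeriv_coe (hW.of_le (by norm_cast; exact Nat.le_succ _)) z]

theorem multiDeriv_sum_cons {s : Multiset E} (hW : ContDiff ℝ (s.card + 1 : ℕ) W) (y : E)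
    {ι : Type*} (S : Finset ι) (v : ι → E) :
    multiDeriv W y ((∑ i ∈ S, v i) ::ₘ s) = ∑ i ∈ S, multiDeriv W y (v i ::ₘ s) := by
  simp only [multiDeriv_cons hW, map_sum]

theorem norm_multiDeriv_le {s : Multiset E} (hW : ContDiff ℝ s.card W) (y : E) :
    ‖multiDeriv W y s‖ ≤ ‖iteratedFDeriv ℝ s.card W y‖ * (s.map norm).prod := by
  obtain ⟨v, hv⟩ := exists_map_univ_eq (s := s) rfl
  have hprod : (s.map norm).prod = ∏ i, ‖v i‖ := by
    conv_lhs => rw [← hv, Multiset.map_map]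
    rfl
  conv_lhs => rw [← hv]
  rw [multiDeriv_map_univ hW, hprod]
  exact ContinuousMultilinearMap.le_opNorm _ _

variable {D : Set ℝ} {t : ℝ} {z : ℝ → E} {z' : E}

theorem hasDerivWithinAt_iteratedFDeriv_apply {k : ℕ} (hW : ContDiff ℝ (k + 1 : ℕ) W)
    (hz : HasDerivWithinAt z z' D t) {v : Fin k → ℝ → E} {v' : Fin k → E}
    (hv : ∀ i, HasDerivWithinAt (v i) (v' i) D t) :
    HasDerivWithinAt (fun r => iteratedFDeriv ℝ k W (z r) fun i => v i r)
      (fderiv ℝ (fun y => iteratedFDeriv ℝ k W y fun i => v i t) (z t) z' +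
        ∑ i, iteratedFDeriv ℝ k W (z t) (Function.update (fun j => v j t) i (v' i))) D t := by
  have hd : DifferentiableAt ℝ (iteratedFDeriv ℝ k W) (z t) :=
    hW.differentiable_iteratedFDeriv (by norm_cast; omega) _
  have hcomp := (hd.hasFDerivAt.comp_hasDerivWithinAt t hz).hasFDerivWithinAt
  refine (hcomp.continuousMultilinearMap_apply
    fun i => (hv i).hasFDerivWithinAt).hasDerivWithinAt.congr_deriv ?_
  rw [fderiv_continuousMultilinear_apply_const_apply hd]
  simp [ContinuousMultilinearMap.toContinuousLinearMap]

theorem map_univ_update {α : Type*} {k : ℕ} (v : Fin k → α) (i : Fin k) (a : α) :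
    Finset.univ.val.map (Function.update v i a) = a ::ₘ (Finset.univ.val.erase i).map v := by
  rw [← Multiset.cons_erase (Finset.mem_univ_val i), Multiset.map_cons, Function.update_self,
    Multiset.erase_cons_head]
  congr 1
  refine Multiset.map_congr rfl fun j hj => Function.update_of_ne ?_ _ _
  exact ((Finset.univ.nodup.mem_erase_iff).1 hj).1

theorem hasDerivWithinAt_multiDeriv {ι : Type*} [DecidableEq ι] {s : Multiset ι}
    (hW : ContDiff ℝ (s.card + 1 : ℕ) W) (hz : HasDerivWithinAt z z' D t)
    {v : ι → ℝ → E} {v' : ι → E} (hv : ∀ i ∈ s, HasDerivWithinAt (v i) (v' i) D t) :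
    HasDerivWithinAt (fun r => multiDeriv W (z r) (s.map fun i => v i r))
      (multiDeriv W (z t) (z' ::ₘ s.map fun i => v i t) +
        (s.map fun i => multiDeriv W (z t) (v' i ::ₘ (s.erase i).map fun j => v j t)).sum) D t := by
  obtain ⟨k, hk⟩ : ∃ k, s.card = k := ⟨_, rfl⟩
  obtain ⟨e, rfl⟩ := exists_map_univ_eq hk
  rw [hk] at hW
  have hWk : ContDiff ℝ k W := hW.of_le (by norm_cast; exact k.le_succ)
  have hval (y : E) (u : ι → E) : multiDeriv W y ((Finset.univ.val.map e).map u) =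
      iteratedFDeriv ℝ k W y fun a => u (e a) := by
    rw [Multiset.map_map, ← multiDeriv_map_univ hWk]
    rfl
  have hve (a : Fin k) : HasDerivWithinAt (v (e a)) (v' (e a)) D t :=
    hv _ (Multiset.mem_map_of_mem e (Finset.mem_univ_val a))
  rw [funext fun r => hval (z r) fun i => v i r]
  refine (hasDerivWithinAt_iteratedFDeriv_apply hW hz hve).congr_deriv ?_
  congr 1
  · rw [multiDeriv_cons (by rwa [Multiset.card_map, hk])]
    simp only [hval]
  · rw [Multiset.map_map]
    refine Finset.sum_congr rfl fun a _ => ?_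
    rw [← multiDeriv_map_univ hWk, map_univ_update, Function.comp_apply,
      ← Multiset.map_erase_of_mem _ _ (Finset.mem_univ_val a), Multiset.map_map]
    rfl

end MultiDeriv

/-- `W` is `n` times continuously differentiable and its derivatives of order `0, …, n` are bounded
by `M`; all error bounds are stated in terms of `M`, which plays the role of `‖W‖_{Cⁿ}`. -/
structure BoundedDerivs {E F : Type*} [NormedAddCommGroup E] [NormedSpace ℝ E]
    [NormedAddCommGroup F] [NormedSpace ℝ F] (n : ℕ) (W : E → F) (M : ℝ) : Prop where
  contDiff : ContDiff ℝ n W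
  norm_iteratedFDeriv_le : ∀ k ≤ n, ∀ y, ‖iteratedFDeriv ℝ k W y‖ ≤ M

namespace BoundedDerivs

variable {E F : Type*} [NormedAddCommGroup E] [NormedSpace ℝ E]
  [NormedAddCommGroup F] [NormedSpace ℝ F] {n : ℕ} {W : E → F} {M : ℝ}

theorem mono (h : BoundedDerivs n W M) {k : ℕ} (hk : k ≤ n) : BoundedDerivs k W M :=
  ⟨h.contDiff.of_le (by exact_mod_cast hk),
    fun j hj => h.norm_iteratedFDeriv_le j (hj.trans hk)⟩

theorem norm_le (h : BoundedDerivs n W M) (y : E) : ‖W y‖ ≤ M := by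
  simpa using h.norm_iteratedFDeriv_le 0 n.zero_le y

theorem nonneg (h : BoundedDerivs n W M) : 0 ≤ M :=
  (norm_nonneg _).trans (h.norm_le 0)

end BoundedDerivs

/-! ### Elementary differentials -/

section ElemDiff

variable {E : Type} [NormedAddCommGroup E] [NormedSpace ℝ E] {W : E → E}

/-- The elementary differential of `W` at `y`:
`F([t₁ ⋯ tₗ]) = W⁽ˡ⁾(F(t₁), …, F(tₗ))`. -/
def elemDiff (W : E → E) (y : E) (t : RTree) : E := t.fold (multiDeriv W y)

theorem elemDiff_node (W : E → E) (y : E) (s : Multiset RTree) :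
    elemDiff W y (RTree.node s) = multiDeriv W y (s.map (elemDiff W y)) :=
  RTree.fold_node _ _

theorem elemDiff_node_map_univ {k : ℕ} (hW : ContDiff ℝ k W) (y : E) (f : Fin k → RTree) :
    elemDiff W y (RTree.node (Finset.univ.val.map f)) =
      iteratedFDeriv ℝ k W y fun i => elemDiff W y (f i) := by
  rw [elemDiff_node, Multiset.map_map, ← multiDeriv_map_univ hW]
  rfl

theorem pow_sum_order (M : ℝ) (s : Multiset RTree) :
    M ^ (s.map RTree.order).sum = (s.map fun t => M ^ t.order).prod := by
  induction s using Multiset.induction with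
  | empty => simp
  | cons t s ih => simp [pow_add, ih]

theorem norm_elemDiff_node_le {n : ℕ} {M : ℝ} (hW : BoundedDerivs n W M) {y : E}
    {s : Multiset RTree} (hcard : s.card ≤ n) (hs : ∀ t ∈ s, ‖elemDiff W y t‖ ≤ M ^ t.order) :
    ‖elemDiff W y (RTree.node s)‖ ≤ M ^ (RTree.node s).order := by
  have hprod : ((s.map (elemDiff W y)).map norm).prod ≤ (s.map fun t => M ^ t.order).prod := by
    rw [Multiset.map_map]
    exact Multiset.prod_map_le_prod_map₀ _ _ (fun _ _ => norm_nonneg _) hs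
  rw [elemDiff_node, RTree.order_node, pow_add, pow_one, pow_sum_order]
  refine (norm_multiDeriv_le ?_ y).trans ?_ <;> rw [Multiset.card_map]
  · exact (hW.mono hcard).contDiff
  · exact mul_le_mul (hW.norm_iteratedFDeriv_le _ hcard y) hprod
      (Multiset.prod_nonneg (by simp)) hW.nonneg

theorem norm_elemDiff_le {n : ℕ} {M : ℝ} (hW : BoundedDerivs n W M) (y : E) {t : RTree}
    (ht : t.order ≤ n + 1) : ‖elemDiff W y t‖ ≤ M ^ t.order := by
  induction t using RTree.induction with
  | h s ih =>
    have hlt {t : RTree} (h : t ∈ s) : t.order < (RTree.node s).order :=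
      RTree.order_lt_of_mem_branches (by rwa [RTree.branches_node])
    have hcard := (RTree.node s).card_branches_lt_order
    rw [RTree.branches_node] at hcard
    exact norm_elemDiff_node_le hW (by omega) fun t h => ih t h ((hlt h).le.trans ht)

end ElemDiff

/-! ### Taylor expansions -/

section Taylor

variable {E : Type*} [NormedAddCommGroup E] [NormedSpace ℝ E]

theorem hasDerivWithinAt_pow_div_factorial_succ (n : ℕ) (t : ℝ) (D : Set ℝ) :
    HasDerivWithinAt (fun s : ℝ => s ^ (n + 1) / (n + 1)!) (t ^ n / n !) D t := by
  refine ((hasDerivWithinAt_id t D).pow (n + 1)).div_const ((n + 1)! : ℝ) |>.congr_deriv ?_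
  rw [Nat.factorial_succ]
  push_cast
  simp
  field_simp

/- Induction on `n`: the derivative of the remainder is the remainder of order `n - 1` of `f 1`. -/
theorem norm_sub_taylor_le {f : ℕ → ℝ → E} {n : ℕ} {C : ℝ}
    (hf : ∀ k < n, ∀ t ∈ Set.Icc (0 : ℝ) 1,
      HasDerivWithinAt (f k) (f (k + 1) t) (Set.Icc 0 1) t)
    (hC : ∀ t ∈ Set.Icc (0 : ℝ) 1, ‖f n t‖ ≤ C) {t : ℝ} (ht : t ∈ Set.Icc (0 : ℝ) 1) :
    ‖f 0 t - ∑ k ∈ Finset.range n, (t ^ k / k !) • f k 0‖ ≤ C := by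
  induction n generalizing f t with
  | zero => simpa using hC t ht
  | succ n ih =>
    set g : ℝ → E := fun s => f 0 s - ∑ k ∈ Finset.range (n + 1), (s ^ k / k !) • f k 0 with hg
    have hg_deriv (s : ℝ) (hs : s ∈ Set.Icc (0 : ℝ) 1) : HasDerivWithinAt g
        (f 1 s - ∑ k ∈ Finset.range n, (s ^ k / k !) • f (k + 1) 0) (Set.Icc 0 1) s := by
      simp only [hg, Finset.sum_range_succ' _ n, pow_zero]
      refine (hf 0 n.succ_pos s hs).sub (HasDerivWithinAt.add_const _ ?_)
      exact HasDerivWithinAt.fun_sum fun k _ =>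
        (hasDerivWithinAt_pow_div_factorial_succ k s _).smul_const _
    have hg_zero : g 0 = 0 := by simp [hg, Finset.sum_range_succ']
    have hC0 : 0 ≤ C := (norm_nonneg _).trans (hC t ht)
    have hmv := (convex_Icc (0 : ℝ) 1).norm_image_sub_le_of_norm_hasDerivWithin_le hg_deriv
      (fun s hs =>
        ih (f := fun k => f (k + 1)) (fun k hk => hf (k + 1) (Nat.succ_lt_succ hk)) hC hs)
      (Set.left_mem_Icc.2 zero_le_one) ht
    rw [hg_zero, sub_zero, sub_zero, Real.norm_of_nonneg ht.1] at hmv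
    exact hmv.trans (mul_le_of_le_one_right hC0 ht.2)

theorem norm_map_add_sub_taylor_le {F : Type*} [NormedAddCommGroup F] [NormedSpace ℝ F]
    {W : E → F} {n : ℕ} {M : ℝ} (hW : BoundedDerivs n W M) (x h : E) :
    ‖W (x + h) - ∑ k ∈ Finset.range n, (k ! : ℝ)⁻¹ • iteratedFDeriv ℝ k W x fun _ => h‖ ≤
      M * ‖h‖ ^ n := by
  have hline (t : ℝ) : HasDerivAt (fun s : ℝ => x + s • h) h t := by
    simpa using ((hasDerivAt_id t).smul_const h).const_add x
  have hderiv (k : ℕ) (hk : k < n) (t : ℝ) :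
      HasDerivAt (fun s : ℝ => iteratedFDeriv ℝ k W (x + s • h) fun _ => h)
        (iteratedFDeriv ℝ (k + 1) W (x + t • h) fun _ => h) t := by
    have hd := hW.contDiff.differentiable_iteratedFDeriv (by exact_mod_cast hk) (x + t • h)
    rw [hd.iteratedFDeriv_succ_apply_left']
    exact (hd.continuousMultilinear_apply_const _).hasFDerivAt.comp_hasDerivAt t (hline t)
  have hbound (t : ℝ) : ‖iteratedFDeriv ℝ n W (x + t • h) fun _ => h‖ ≤ M * ‖h‖ ^ n :=
    (ContinuousMultilinearMap.le_opNorm_mul_pow_of_le _ (pi_norm_const_le h)).trans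
      (by gcongr; exact hW.norm_iteratedFDeriv_le n le_rfl _)
  simpa using norm_sub_taylor_le (fun k hk t _ => (hderiv k hk t).hasDerivWithinAt)
    (fun t _ => hbound t) (Set.right_mem_Icc.2 zero_le_one)

end Taylor

namespace LTree

/-! ### Structure of labelled trees -/

theorem eq_of_V_E {u u' : LTree} (hV : u.V = u'.V) (hE : u.E = u'.E) : u = u' := by
  cases u; cases u'; cases hV; cases hE; rfl

section Structure

variable {u : LTree} {x y : ℤ}

/-- The parent relation of a labelled tree: `x` is the parent of `y`. -/
def Edge (u : LTree) (x y : ℤ) : Prop := (x, y) ∈ u.E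

/-- The ancestor relation of a labelled tree: there is a directed path, possibly of length `0`,
from `x` to `y`. -/
abbrev Reaches (u : LTree) (x y : ℤ) : Prop := Relation.ReflTransGen u.Edge x y

theorem Edge.lt (h : u.Edge x y) : x < y := (u.edge_mem _ h).2.2

theorem Edge.left_mem (h : u.Edge x y) : x ∈ u.V := (u.edge_mem _ h).1

theorem Edge.right_mem (h : u.Edge x y) : y ∈ u.V := (u.edge_mem _ h).2.1

theorem Reaches.le (h : u.Reaches x y) : x ≤ y := by
  induction h with
  | refl => exact le_rfl
  | tail _ h ih => exact ih.trans h.lt.le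

theorem Reaches.mem (h : u.Reaches x y) (hx : x ∈ u.V) : y ∈ u.V := by
  induction h with
  | refl => exact hx
  | tail _ h _ => exact h.right_mem

theorem mem_children : y ∈ u.children x ↔ u.Edge x y := by
  rw [children, Finset.mem_filter]
  exact ⟨fun h => h.2, fun h => ⟨Edge.right_mem h, h⟩⟩

theorem branches_shapeAt (u : LTree) (x : ℤ) :
    (u.shapeAt x).branches = (u.children x).val.map u.shapeAt := by
  rw [shapeAt, RTree.branches_node]
  exact Multiset.attach_map_val' (u.children x).val u.shapeAt

theorem shapeAt_eq (u : LTree) (x : ℤ) :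
    u.shapeAt x = RTree.node ((u.children x).val.map u.shapeAt) := by
  rw [← branches_shapeAt, RTree.node_branches]

theorem card_children_lt_order (u : LTree) (x : ℤ) :
    (u.children x).card < (u.shapeAt x).order := by
  have h := (u.shapeAt x).card_branches_lt_order
  rwa [branches_shapeAt, Multiset.card_map] at h

theorem order_shapeAt_lt (hxy : u.Edge x y) : (u.shapeAt y).order < (u.shapeAt x).order := by
  refine RTree.order_lt_of_mem_branches ?_
  rw [branches_shapeAt]
  exact Multiset.mem_map_of_mem _ (mem_children.2 hxy)

theorem children_induction (u : LTree) {p : ℤ → Prop}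
    (h : ∀ x, (∀ y, u.Edge x y → p y) → p x) (x : ℤ) : p x :=
  shapeAt.induct u p (fun x ih => h x fun y hy => ih ⟨y, mem_children.2 hy⟩) x

theorem eq_of_siblings_of_reaches {c c' : ℤ} (hc : u.Edge x c) (hc' : u.Edge x c')
    (h : u.Reaches c c') : c = c' := by
  rcases Relation.ReflTransGen.cases_tail h with rfl | ⟨d, hcd, hd⟩
  · rfl
  · obtain rfl : d = x := u.parent_unique d x c' hd hc'
    exact absurd (Reaches.le hcd) hc.lt.not_ge

theorem eq_of_edge_of_reaches {c c' : ℤ} (hc : u.Edge x c) (hc' : u.Edge x c')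
    (h : u.Reaches c y) (h' : u.Reaches c' y) : c = c' := by
  have unique_parent : Relator.RightUnique (Function.swap u.Edge) :=
    fun a b d hb hd => u.parent_unique b d a hb hd
  rcases Relation.ReflTransGen.total_of_right_unique unique_parent h.swap h'.swap with hr | hr
  · exact (eq_of_siblings_of_reaches hc' hc hr.swap).symm
  · exact eq_of_siblings_of_reaches hc hc' hr.swap

open Classical in
/-- The vertex set of the subtree of `u` with root `x`. -/
def desc (u : LTree) (x : ℤ) : Finset ℤ := u.V.filter fun v => u.Reaches x v

open Classical in
theorem mem_desc (hx : x ∈ u.V) : y ∈ u.desc x ↔ u.Reaches x y := by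
  rw [desc, Finset.mem_filter]
  exact ⟨fun h => h.2, fun h => ⟨Reaches.mem h hx, h⟩⟩

theorem mem_desc_of_edge {c : ℤ} (hc : u.Edge x c) : y ∈ u.desc c ↔ u.Reaches c y :=
  mem_desc hc.right_mem

theorem desc_eq_insert (hx : x ∈ u.V) :
    u.desc x = insert x ((u.children x).biUnion u.desc) := by
  ext v
  rw [mem_desc hx, Finset.mem_insert, Finset.mem_biUnion]
  constructor
  · intro h
    rcases Relation.ReflTransGen.cases_head h with rfl | ⟨c, hc, hcv⟩
    · exact Or.inl rfl
    · exact Or.inr ⟨c, mem_children.2 hc, (mem_desc_of_edge hc).2 hcv⟩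
  · rintro (rfl | ⟨c, hc, hcv⟩)
    · exact Relation.ReflTransGen.refl
    · have hc := mem_children.1 hc
      exact Relation.ReflTransGen.head hc ((mem_desc_of_edge hc).1 hcv)

theorem sum_desc {M : Type*} [AddCommMonoid M] (hx : x ∈ u.V) (f : ℤ → M) :
    ∑ v ∈ u.desc x, f v = f x + ∑ c ∈ u.children x, ∑ v ∈ u.desc c, f v := by
  have hnot : x ∉ (u.children x).biUnion u.desc := fun h => by
    obtain ⟨c, hc, hcx⟩ := Finset.mem_biUnion.1 h
    have hc := mem_children.1 hc
    exact absurd ((mem_desc_of_edge hc).1 hcx).le hc.lt.not_ge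
  rw [desc_eq_insert hx, Finset.sum_insert hnot, Finset.sum_biUnion]
  intro c hc c' hc' hne
  have hc := mem_children.1 hc
  have hc' := mem_children.1 hc'
  exact Finset.disjoint_left.2 fun v hv hv' => hne <| eq_of_edge_of_reaches hc hc'
    ((mem_desc_of_edge hc).1 hv) ((mem_desc_of_edge hc').1 hv')

theorem order_shapeAt (hx : x ∈ u.V) : (u.shapeAt x).order = (u.desc x).card := by
  induction x using children_induction u with
  | h x ih =>
    rw [shapeAt_eq, RTree.order_node, Multiset.map_map, Finset.card_eq_sum_ones, sum_desc hx]
    congr 1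
    refine Finset.sum_congr rfl fun c hc => ?_
    have hc := mem_children.1 hc
    rw [← Finset.card_eq_sum_ones]
    exact ih c hc hc.right_mem

theorem root_mem (u : LTree) : u.root ∈ u.V := Finset.min'_mem _ _

theorem root_le (hx : x ∈ u.V) : u.root ≤ x := Finset.min'_le _ _ hx

theorem exists_parent (hy : y ∈ u.V) (hne : y ≠ u.root) : ∃ x, u.Edge x y := by
  have hlt {a b : ℤ} (h : Relation.TransGen u.Edge a b) : a < b :=
    h.trans_induction_on (fun h => h.lt) fun _ _ => lt_trans
  rcases u.connected u.root u.root_mem y hy hne.symm with h | h | ⟨z, hz, -, -, h, -⟩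
  · obtain ⟨x, -, hx⟩ := Relation.TransGen.tail'_iff.1 h
    exact ⟨x, hx⟩
  · exact absurd (hlt h) (root_le hy).not_gt
  · exact absurd (hlt h) (root_le hz).not_gt

theorem root_reaches (hy : y ∈ u.V) : u.Reaches u.root y := by
  induction y using Int.strongRec (m := u.root) with
  | lt y hlt => exact absurd (root_le hy) hlt.not_ge
  | ge y _ ih =>
    by_cases hne : y = u.root
    · rw [hne]
    · obtain ⟨x, hx⟩ := exists_parent hy hne
      exact (ih x hx.lt hx.left_mem).tail hx

theorem desc_root (u : LTree) : u.desc u.root = u.V := by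
  ext v
  exact ⟨fun h => ((mem_desc u.root_mem).1 h).mem u.root_mem,
    fun h => (mem_desc u.root_mem).2 (root_reaches h)⟩

theorem order_shape (u : LTree) : u.shape.order = u.V.card := by
  rw [shape, order_shapeAt u.root_mem, desc_root]

end Structure

section OfParents

variable {V : Finset ℤ} {E : Finset (ℤ × ℤ)} (hV : V.Nonempty)
  (hE : ∀ e ∈ E, e.1 ∈ V ∧ e.2 ∈ V ∧ e.1 < e.2)
  (hpar : ∀ y ∈ V, y ≠ V.min' hV → ∃ x, (x, y) ∈ E)
include hE hpar

theorem transGen_min' {y : ℤ} (hy : y ∈ V) (hne : y ≠ V.min' hV) :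
    Relation.TransGen (fun a b => (a, b) ∈ E) (V.min' hV) y := by
  induction y using Int.strongRec (m := V.min' hV) with
  | lt y hlt => exact absurd (V.min'_le _ hy) hlt.not_ge
  | ge y _ ih =>
    obtain ⟨x, hx⟩ := hpar y hy hne
    by_cases h : x = V.min' hV
    · exact h ▸ Relation.TransGen.single hx
    · exact (ih x (hE _ hx).2.2 (hE _ hx).1 h).tail hx

/-- The labelled tree given by a set of increasing edges in which every vertex but the least one
has exactly one parent. -/
def ofParents (huniq : ∀ x x' y : ℤ, (x, y) ∈ E → (x', y) ∈ E → x = x') : LTree where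
  V := V
  E := E
  nonempty := hV
  edge_mem := hE
  parent_unique := huniq
  connected x hx y hy hxy := by
    have hroot {y : ℤ} := transGen_min' hV hE hpar (y := y)
    by_cases h : x = V.min' hV
    · exact Or.inl (h ▸ hroot hy (h ▸ hxy.symm))
    by_cases h' : y = V.min' hV
    · exact Or.inr (Or.inl (h' ▸ hroot hx h))
    exact Or.inr (Or.inr ⟨_, V.min'_mem hV, Ne.symm h, Ne.symm h', hroot hx h, hroot hy h'⟩)

end OfParents

/-! ### Adding and removing the leaf with the largest label -/

theorem min'_insert_of_lt {V : Finset ℤ} (hV : V.Nonempty) {w : ℤ} (hw : ∀ z ∈ V, z < w) :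
    (insert w V).min' (Finset.insert_nonempty w V) = V.min' hV := by
  rw [Finset.min'_insert w V hV]
  exact min_eq_right (hw _ (V.min'_mem hV)).le

theorem not_edge_of_lt {u : LTree} {w : ℤ} (hw : ∀ z ∈ u.V, z < w) (x : ℤ) : ¬ u.Edge x w :=
  fun h => (hw w h.right_mem).false

/-- The tree with a new leaf `w`, larger than all vertices, attached to the vertex `v`. -/
def attachLeaf (u : LTree) (v w : ℤ) (hv : v ∈ u.V) (hw : ∀ z ∈ u.V, z < w) : LTree :=
  ofParents (V := insert w u.V) (E := insert (v, w) u.E) (Finset.insert_nonempty _ _)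
    (by
      rw [Finset.forall_mem_insert]
      refine ⟨⟨Finset.mem_insert_of_mem hv, Finset.mem_insert_self _ _, hw v hv⟩, fun e he => ?_⟩
      exact (u.edge_mem e he).imp Finset.mem_insert_of_mem (.imp_left Finset.mem_insert_of_mem))
    (by
      intro y hy hne
      rw [min'_insert_of_lt u.nonempty hw] at hne
      rcases Finset.mem_insert.1 hy with rfl | hy
      · exact ⟨v, Finset.mem_insert_self _ _⟩
      · obtain ⟨x, hx⟩ := exists_parent hy hne
        exact ⟨x, Finset.mem_insert_of_mem hx⟩)
    (by
      simp only [Finset.mem_insert, Prod.mk.injEq]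
      rintro x x' y (⟨rfl, rfl⟩ | h) (⟨rfl, hy⟩ | h')
      · rfl
      · exact absurd h' (not_edge_of_lt hw _)
      · exact absurd (hy ▸ h) (not_edge_of_lt hw _)
      · exact u.parent_unique x x' y h h')

open Classical in
/-- The tree with a new leaf `w` attached to `v`, as in `attachLeaf`; by convention it is `u` unless
`v` is a vertex and `w` is larger than all vertices. -/
def addLeaf (u : LTree) (v w : ℤ) : LTree :=
  if h : v ∈ u.V ∧ ∀ z ∈ u.V, z < w then u.attachLeaf v w h.1 h.2 else u

section AddLeaf

variable {u : LTree} {v w : ℤ} (hv : v ∈ u.V) (hw : ∀ z ∈ u.V, z < w)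
include hv hw

theorem addLeaf_V : (u.addLeaf v w).V = insert w u.V := by
  rw [addLeaf, dif_pos ⟨hv, hw⟩]; rfl

theorem addLeaf_E : (u.addLeaf v w).E = insert (v, w) u.E := by
  rw [addLeaf, dif_pos ⟨hv, hw⟩]; rfl

theorem addLeaf_edge {x y : ℤ} : (u.addLeaf v w).Edge x y ↔ (x = v ∧ y = w) ∨ u.Edge x y := by
  rw [Edge, addLeaf_E hv hw, Finset.mem_insert, Prod.mk.injEq]
  rfl

theorem addLeaf_root : (u.addLeaf v w).root = u.root := by
  simp only [root, addLeaf_V hv hw]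
  exact min'_insert_of_lt u.nonempty hw

theorem children_addLeaf_self : (u.addLeaf v w).children v = insert w (u.children v) := by
  ext y
  simp [mem_children, addLeaf_edge hv hw]

theorem children_addLeaf_of_ne {x : ℤ} (hx : x ≠ v) :
    (u.addLeaf v w).children x = u.children x := by
  ext y
  simp [mem_children, addLeaf_edge hv hw, hx]

theorem shapeAt_addLeaf_of_not_reaches {x : ℤ} (hx : ¬ u.Reaches x v) :
    (u.addLeaf v w).shapeAt x = u.shapeAt x := by
  induction x using children_induction u with
  | h x ih =>
    have hne : x ≠ v := fun h => hx (h ▸ Relation.ReflTransGen.refl)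
    rw [shapeAt_eq, shapeAt_eq, children_addLeaf_of_ne hv hw hne]
    congr 1
    refine Multiset.map_congr rfl fun c hc => ?_
    have hc := mem_children.1 hc
    exact ih c hc fun h => hx (Relation.ReflTransGen.head hc h)

theorem shapeAt_addLeaf_leaf : (u.addLeaf v w).shapeAt w = RTree.node 0 := by
  have hchildren : u.children w = ∅ := Finset.eq_empty_of_forall_notMem fun y hy =>
    (hw w (mem_children.1 hy).left_mem).false
  rw [shapeAt_addLeaf_of_not_reaches hv hw fun h => h.le.not_gt (hw v hv), shapeAt_eq, hchildren]
  rfl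

theorem shapeAt_addLeaf_self :
    (u.addLeaf v w).shapeAt v = RTree.node (RTree.node 0 ::ₘ (u.children v).val.map u.shapeAt) := by
  have hnot : w ∉ u.children v := fun h => not_edge_of_lt hw v (mem_children.1 h)
  rw [shapeAt_eq, children_addLeaf_self hv hw, Finset.insert_val_of_notMem hnot, Multiset.map_cons,
    shapeAt_addLeaf_leaf hv hw]
  congr 2
  exact Multiset.map_congr rfl fun c hc => shapeAt_addLeaf_of_not_reaches hv hw
    fun h => h.le.not_gt (mem_children.1 hc).lt

theorem shapeAt_addLeaf_of_child {x c : ℤ} (hc : c ∈ u.children x) (hcv : u.Reaches c v) :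
    (u.addLeaf v w).shapeAt x = RTree.node ((u.addLeaf v w).shapeAt c ::ₘ
      ((u.children x).val.erase c).map u.shapeAt) := by
  have hxc := mem_children.1 hc
  have hne : x ≠ v := (hxc.lt.trans_le hcv.le).ne
  rw [shapeAt_eq, children_addLeaf_of_ne hv hw hne]
  conv_lhs => rw [← Multiset.cons_erase (Finset.mem_def.1 hc), Multiset.map_cons]
  congr 2
  refine Multiset.map_congr rfl fun d hd => shapeAt_addLeaf_of_not_reaches hv hw fun h => ?_
  obtain ⟨hdc, hd⟩ := ((u.children x).nodup.mem_erase_iff).1 hd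
  exact hdc (eq_of_edge_of_reaches (mem_children.1 hd) hxc h hcv)

end AddLeaf

theorem addLeaf_injective {u u' : LTree} {v v' w : ℤ} (hV : u.V = u'.V) (hv : v ∈ u.V)
    (hv' : v' ∈ u'.V) (hw : ∀ z ∈ u.V, z < w) (h : u.addLeaf v w = u'.addLeaf v' w) :
    u = u' ∧ v = v' := by
  have hw' : ∀ z ∈ u'.V, z < w := hV ▸ hw
  have hE := congrArg E h
  rw [addLeaf_E hv hw, addLeaf_E hv' hw'] at hE
  obtain rfl : v = v' := by
    have hmem : (v, w) ∈ insert (v', w) u'.E := hE ▸ Finset.mem_insert_self _ _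
    rcases Finset.mem_insert.1 hmem with heq | hmem
    · exact congrArg Prod.fst heq
    · exact absurd hmem (not_edge_of_lt hw' v)
  refine ⟨eq_of_V_E hV ?_, rfl⟩
  rw [← Finset.erase_insert (not_edge_of_lt hw v), hE, Finset.erase_insert (not_edge_of_lt hw' v)]

section RemoveLeaf

variable {u : LTree} {V : Finset ℤ} {w : ℤ}

theorem root_eq_min' (hV : V.Nonempty) (hw : ∀ z ∈ V, z < w) (hu : u.V = insert w V) :
    u.root = V.min' hV := by
  simp only [root, hu, min'_insert_of_lt hV hw]

theorem left_mem_of_edge (hw : ∀ z ∈ V, z < w) (hu : u.V = insert w V) {x y : ℤ}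
    (h : u.Edge x y) : x ∈ V := by
  have hle : y ≤ w := by
    rcases Finset.mem_insert.1 (hu ▸ h.right_mem) with rfl | hy
    exacts [le_rfl, (hw y hy).le]
  exact Finset.mem_of_mem_insert_of_ne (hu ▸ h.left_mem) (h.lt.trans_le hle).ne

/-- The tree without its largest vertex `w`, where `V` is the set of the remaining vertices. -/
def removeLeaf (u : LTree) (hV : V.Nonempty) (hw : ∀ z ∈ V, z < w) (hu : u.V = insert w V) :
    LTree :=
  ofParents (V := V) (E := u.E.filter fun e => e.2 ≠ w) hV
    (fun e he => by
      obtain ⟨he, hne⟩ := Finset.mem_filter.1 he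
      obtain ⟨-, h, hlt⟩ := u.edge_mem e he
      exact ⟨left_mem_of_edge hw hu he, Finset.mem_of_mem_insert_of_ne (hu ▸ h) hne, hlt⟩)
    (fun y hy hne => by
      rw [← root_eq_min' hV hw hu] at hne
      obtain ⟨x, hx⟩ := exists_parent (hu ▸ Finset.mem_insert_of_mem hy) hne
      exact ⟨x, Finset.mem_filter.2 ⟨hx, (hw y hy).ne⟩⟩)
    (fun x x' y h h' => u.parent_unique x x' y (Finset.mem_filter.1 h).1 (Finset.mem_filter.1 h').1)

theorem exists_addLeaf_eq (hV : V.Nonempty) (hw : ∀ z ∈ V, z < w) (hu : u.V = insert w V) :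
    ∃ u' : LTree, u'.V = V ∧ ∃ v ∈ V, u'.addLeaf v w = u := by
  have hroot : w ≠ u.root := by
    rw [root_eq_min' hV hw hu]
    exact (hw _ (V.min'_mem hV)).ne'
  obtain ⟨v, hvw⟩ := exists_parent (hu ▸ Finset.mem_insert_self w V) hroot
  have hv : v ∈ V := left_mem_of_edge hw hu hvw
  refine ⟨u.removeLeaf hV hw hu, rfl, v, hv, eq_of_V_E ?_ ?_⟩
  · exact (addLeaf_V (u := u.removeLeaf hV hw hu) hv hw).trans hu.symm
  · refine (addLeaf_E (u := u.removeLeaf hV hw hu) hv hw).trans (Finset.ext fun ⟨x, y⟩ => ?_)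
    change _ ∈ insert _ (u.E.filter fun e => e.2 ≠ w) ↔ _
    rw [Finset.mem_insert, Finset.mem_filter, Prod.mk.injEq]
    constructor
    · rintro (⟨rfl, rfl⟩ | h)
      exacts [hvw, h.1]
    · intro h
      by_cases hy : y = w
      · subst hy
        exact Or.inl ⟨u.parent_unique _ _ _ h hvw, rfl⟩
      · exact Or.inr ⟨h, hy⟩

end RemoveLeaf

/-! ### Sums over labelled trees -/

theorem finite_setOf_V_eq (V : Finset ℤ) : {u : LTree | u.V = V}.Finite := by
  refine Set.Finite.of_finite_image (f := LTree.E) ?_ fun u hu u' hu' h =>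
    eq_of_V_E (Eq.trans hu (Eq.symm hu')) h
  refine (Finset.finite_toSet (V ×ˢ V).powerset).subset ?_
  rintro _ ⟨u, rfl, rfl⟩
  refine Finset.mem_coe.2 (Finset.mem_powerset.2 fun e he => ?_)
  exact Finset.mem_product.2 ⟨(u.edge_mem e he).1, (u.edge_mem e he).2.1⟩

/-- The labelled trees with vertex set `V`. -/
def treesOn (V : Finset ℤ) : Finset LTree := (finite_setOf_V_eq V).toFinset

theorem mem_treesOn {V : Finset ℤ} {u : LTree} : u ∈ treesOn V ↔ u.V = V := by
  simp [treesOn]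

theorem order_shape_of_mem_treesOn {V : Finset ℤ} {u : LTree} (hu : u ∈ treesOn V) :
    u.shape.order = V.card := by
  rw [order_shape, mem_treesOn.1 hu]

theorem sum_treesOn_insert {M : Type*} [AddCommMonoid M] {V : Finset ℤ} {w : ℤ} (hV : V.Nonempty)
    (hw : ∀ z ∈ V, z < w) (f : LTree → M) :
    ∑ u ∈ treesOn (insert w V), f u = ∑ u ∈ treesOn V, ∑ v ∈ V, f (u.addLeaf v w) := by
  rw [Finset.sum_sigma']
  symm
  refine Finset.sum_bij (fun p _ => p.1.addLeaf p.2 w) ?_ ?_ ?_ fun _ _ => rfl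
  · rintro ⟨u, v⟩ h
    simp only [Finset.mem_sigma, mem_treesOn] at h ⊢
    obtain ⟨rfl, hv⟩ := h
    exact addLeaf_V hv hw
  · rintro ⟨u, v⟩ h ⟨u', v'⟩ h' heq
    simp only [Finset.mem_sigma, mem_treesOn] at h h'
    obtain ⟨rfl, hv⟩ := h
    obtain ⟨hu', hv'⟩ := h'
    obtain ⟨rfl, rfl⟩ := addLeaf_injective hu'.symm hv (hu' ▸ hv') hw heq
    rfl
  · intro u hu
    obtain ⟨u', rfl, v, hv, rfl⟩ := exists_addLeaf_eq hV hw (mem_treesOn.1 hu)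
    exact ⟨⟨u', v⟩, Finset.mem_sigma.2 ⟨mem_treesOn.2 rfl, hv⟩, rfl⟩

theorem sum_treesOn_singleton {M : Type*} [AddCommMonoid M] (x : ℤ) (f : RTree → M) :
    ∑ u ∈ treesOn {x}, f u.shape = f (RTree.node 0) := by
  let singleVertex : LTree :=
    ofParents (V := {x}) (E := ∅) (Finset.singleton_nonempty x) (by simp) (by simp) (by simp)
  have htrees : treesOn {x} = {singleVertex} := by
    ext u
    rw [mem_treesOn, Finset.mem_singleton]
    refine ⟨fun hV => eq_of_V_E hV (Finset.eq_empty_of_forall_notMem fun e he => ?_),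
      fun h => h ▸ rfl⟩
    obtain ⟨h1, h2, hlt⟩ := u.edge_mem e he
    rw [hV, Finset.mem_singleton] at h1 h2
    exact hlt.ne (h1.trans h2.symm)
  rw [htrees, Finset.sum_singleton, shape, shapeAt_eq]
  rfl

theorem labellings_eq_card (t : RTree) [DecidablePred fun u : LTree => u.shape = t] :
    t.labellings = ((treesOn (Finset.Icc 1 t.order)).filter fun u => u.shape = t).card :=
  Nat.subtype_card _ fun u => by rw [Finset.mem_filter, mem_treesOn]

theorem sum_treesOn_Icc {M : Type*} [AddCommMonoid M] {n m : ℕ} (hnm : n ≤ m) (f : RTree → M) :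
    ∑ u ∈ treesOn (Finset.Icc 1 n), f u.shape =
      ∑ t ∈ (RTree.upTo m).filter fun t => t.order = n, t.labellings • f t := by
  classical
  have hmaps : ∀ u ∈ treesOn (Finset.Icc 1 n),
      u.shape ∈ (RTree.upTo m).filter fun t => t.order = n := fun u hu => by
    have horder : u.shape.order = n := by simpa using order_shape_of_mem_treesOn hu
    exact Finset.mem_filter.2 ⟨RTree.mem_upTo.2 (horder.trans_le hnm), horder⟩
  rw [← Finset.sum_fiberwise_of_maps_to hmaps]
  refine Finset.sum_congr rfl fun t ht => ?_
  obtain rfl := (Finset.mem_filter.1 ht).2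
  rw [labellings_eq_card, ← Finset.sum_const]
  exact Finset.sum_congr rfl fun u hu => by rw [(Finset.mem_filter.1 hu).2]

end LTree

/-! ### Taylor expansion of the exact solution -/

section Flow

variable {E : Type} [NormedAddCommGroup E] [NormedSpace ℝ E] {W : E → E} {z : ℝ → E}

/- Attaching `w` to `x` itself corresponds to differentiating `W⁽ˡ⁾(z)`, attaching it below a child
`c` of `x` to differentiating the argument of `W⁽ˡ⁾(z)` that belongs to `c`. -/
theorem LTree.hasDerivWithinAt_elemDiff_shapeAt {n : ℕ} (hW : ContDiff ℝ n W) {D : Set ℝ} {t : ℝ}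
    (hz : HasDerivWithinAt z (W (z t)) D t) {u : LTree} {w : ℤ} (hw : ∀ y ∈ u.V, y < w) {x : ℤ}
    (hx : x ∈ u.V) (hn : (u.shapeAt x).order ≤ n) :
    HasDerivWithinAt (fun s => elemDiff W (z s) (u.shapeAt x))
      (∑ v ∈ u.desc x, elemDiff W (z t) ((u.addLeaf v w).shapeAt x)) D t := by
  induction x using children_induction u with
  | h x ih =>
    have helem (y : E) : elemDiff W y (u.shapeAt x) =
        multiDeriv W y ((u.children x).val.map fun c => elemDiff W y (u.shapeAt c)) := by
      rw [shapeAt_eq, elemDiff_node, Multiset.map_map]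
      rfl
    have hcard : (u.children x).card + 1 ≤ n := (u.card_children_lt_order x).trans_le hn
    have hsmooth : ContDiff ℝ ((u.children x).val.card + 1 : ℕ) W :=
      hW.of_le (by exact_mod_cast hcard)
    have hchild (c : ℤ) (hc : c ∈ (u.children x).val) :=
      have hxc := mem_children.1 hc
      ih c hxc hxc.right_mem ((order_shapeAt_lt hxc).le.trans hn)
    simp only [helem]
    refine (hasDerivWithinAt_multiDeriv hsmooth hz hchild).congr_deriv ?_
    rw [sum_desc hx, shapeAt_addLeaf_self hx hw, elemDiff_node, Multiset.map_cons, elemDiff_node,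
      Multiset.map_zero, multiDeriv_zero, Multiset.map_map]
    refine congrArg _ (Finset.sum_congr rfl fun c hc => ?_)
    have hcV := (mem_children.1 hc).right_mem
    have herase : ((u.children x).val.erase c).card + 1 ≤ n :=
      (Nat.succ_le_succ (Multiset.card_le_card (Multiset.erase_le _ _))).trans hcard
    rw [multiDeriv_sum_cons (by rw [Multiset.card_map]; exact hW.of_le (by exact_mod_cast herase))]
    refine Finset.sum_congr rfl fun v hv => ?_
    have hcv := (mem_desc hcV).1 hv
    rw [shapeAt_addLeaf_of_child (hcv.mem hcV) hw hc hcv, elemDiff_node, Multiset.map_cons,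
      Multiset.map_map]
    rfl

theorem LTree.hasDerivWithinAt_elemDiff_shape {u : LTree} (hW : ContDiff ℝ u.V.card W) {D : Set ℝ}
    {t : ℝ} (hz : HasDerivWithinAt z (W (z t)) D t) {w : ℤ} (hw : ∀ y ∈ u.V, y < w) :
    HasDerivWithinAt (fun s => elemDiff W (z s) u.shape)
      (∑ v ∈ u.V, elemDiff W (z t) (u.addLeaf v w).shape) D t := by
  refine (hasDerivWithinAt_elemDiff_shapeAt hW hz hw u.root_mem u.order_shape.le).congr_deriv ?_
  rw [desc_root]
  exact Finset.sum_congr rfl fun v hv => by rw [shape, addLeaf_root hv hw]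

/-- The `k`-th derivative of a solution `z` of `z' = W(z)`, expressed through `W`: for `k ≥ 1` it is
the sum of the elementary differentials of all labelled trees on `{1, …, k}`. -/
def flowDeriv (W : E → E) (z : ℝ → E) : ℕ → ℝ → E
  | 0 => z
  | k + 1 => fun t => ∑ u ∈ LTree.treesOn (Finset.Icc 1 (k + 1 : ℕ)), elemDiff W (z t) u.shape

theorem hasDerivWithinAt_flowDeriv {k : ℕ} (hW : ContDiff ℝ k W) {D : Set ℝ} {t : ℝ}
    (hz : HasDerivWithinAt z (W (z t)) D t) :
    HasDerivWithinAt (flowDeriv W z k) (flowDeriv W z (k + 1) t) D t := by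
  cases k with
  | zero =>
    refine hz.congr_deriv (Eq.symm ?_)
    simp only [flowDeriv, Nat.zero_add, Nat.cast_one, Finset.Icc_self]
    rw [LTree.sum_treesOn_singleton, elemDiff_node, Multiset.map_zero, multiDeriv_zero]
  | succ k =>
    have hIcc : insert ((k + 1 : ℕ) + 1 : ℤ) (Finset.Icc 1 ((k + 1 : ℕ) : ℤ)) =
        Finset.Icc 1 ((k + 1 + 1 : ℕ) : ℤ) := by
      rw [Finset.insert_Icc_right_eq_Icc_add_one (by omega)]
      push_cast
      rfl
    have hlt : ∀ y ∈ Finset.Icc 1 ((k + 1 : ℕ) : ℤ), y < (k + 1 : ℕ) + 1 :=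
      fun y hy => Int.lt_add_one_of_le (Finset.mem_Icc.1 hy).2
    simp only [flowDeriv]
    rw [← hIcc, LTree.sum_treesOn_insert ⟨1, by simp⟩ hlt]
    refine HasDerivWithinAt.fun_sum fun u hu => ?_
    have hV := LTree.mem_treesOn.1 hu
    rw [← hV] at hlt ⊢
    exact LTree.hasDerivWithinAt_elemDiff_shape (by simpa [hV] using hW) hz hlt

theorem norm_flowDeriv_succ_le {n : ℕ} {M : ℝ} (hW : BoundedDerivs n W M) (t : ℝ) :
    ‖flowDeriv W z (n + 1) t‖ ≤
      (LTree.treesOn (Finset.Icc 1 (n + 1 : ℕ))).card * M ^ (n + 1) := by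
  rw [← nsmul_eq_mul]
  refine norm_sum_le_of_le _ (fun u hu => ?_) |>.trans_eq (Finset.sum_const _)
  have horder : u.shape.order = n + 1 := by simpa using LTree.order_shape_of_mem_treesOn hu
  exact horder ▸ norm_elemDiff_le hW (z t) horder.le

theorem sum_flowDeriv (W : E → E) (z : ℝ → E) (m : ℕ) (t : ℝ) :
    ∑ k ∈ Finset.range (m + 1), (1 / k ! : ℝ) • flowDeriv W z k t =
      z t + ∑ τ ∈ RTree.upTo m, (τ.labellings / τ.order ! : ℝ) • elemDiff W (z t) τ := by
  have hmaps : ∀ τ ∈ RTree.upTo m, τ.order ∈ Finset.range (m + 1) := fun τ hτ =>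
    Finset.mem_range_succ_iff.2 (RTree.mem_upTo.1 hτ)
  have hempty : (RTree.upTo m).filter (fun τ => τ.order = 0) = ∅ :=
    Finset.filter_eq_empty_iff.2 fun {τ} _ => τ.order_pos.ne'
  rw [← Finset.sum_fiberwise_of_maps_to hmaps, Finset.sum_range_succ', Finset.sum_range_succ',
    hempty, Finset.sum_empty, add_zero, add_comm]
  refine congrArg₂ _ (by simp [flowDeriv]) (Finset.sum_congr rfl fun k hk => ?_)
  simp only [flowDeriv]
  rw [LTree.sum_treesOn_Icc (n := k + 1) (Finset.mem_range.1 hk), Finset.smul_sum]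
  refine Finset.sum_congr rfl fun τ hτ => ?_
  rw [(Finset.mem_filter.1 hτ).2, ← Nat.cast_smul_eq_nsmul ℝ, smul_smul, one_div_mul_eq_div]

theorem norm_flow_sub_le {m : ℕ} {M : ℝ} (hW : BoundedDerivs m W M)
    (hz : ∀ t ∈ Set.Icc (0 : ℝ) 1, HasDerivWithinAt z (W (z t)) (Set.Icc 0 1) t) :
    ‖z 1 - (z 0 + ∑ τ ∈ RTree.upTo m, (τ.labellings / τ.order ! : ℝ) • elemDiff W (z 0) τ)‖ ≤
      (LTree.treesOn (Finset.Icc 1 (m + 1 : ℕ))).card * M ^ (m + 1) := by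
  have htaylor := norm_sub_taylor_le (f := flowDeriv W z) (n := m + 1)
    (fun k hk t ht => hasDerivWithinAt_flowDeriv
      (hW.mono (Nat.lt_succ_iff.1 hk)).contDiff (hz t ht))
    (fun t _ => norm_flowDeriv_succ_le hW t) (Set.right_mem_Icc.2 zero_le_one)
  simp only [one_pow] at htaylor
  rwa [sum_flowDeriv] at htaylor

end Flow

/-! ### Truncated B-series -/

section BSeries

variable {E : Type} [NormedAddCommGroup E] [NormedSpace ℝ E]

/-- The B-series with coefficients `a`, in Butcher's normalisation and truncated after the trees
with `n` vertices. -/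
def bSeries (n : ℕ) (a : RTree → ℝ) (W : E → E) (x : E) : E :=
  ∑ t ∈ RTree.upTo n, (a t / t.symmetry) • elemDiff W x t

theorem bSeries_zero (a : RTree → ℝ) (W : E → E) (x : E) : bSeries 0 a W x = 0 := by
  rw [bSeries, RTree.upTo_zero, Finset.sum_empty]

theorem bSeries_sum {ι : Type*} (s : Finset ι) (c : ι → ℝ) (a : ι → RTree → ℝ) (n : ℕ)
    (W : E → E) (x : E) :
    bSeries n (fun t => ∑ j ∈ s, c j * a j t) W x = ∑ j ∈ s, c j • bSeries n (a j) W x := by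
  simp only [bSeries, Finset.smul_sum, smul_smul, Finset.sum_div, Finset.sum_smul, mul_div_assoc]
  exact Finset.sum_comm

theorem iteratedFDeriv_bSeries {k : ℕ} {W : E → E} (hW : ContDiff ℝ k W) (q : ℕ) (a : RTree → ℝ)
    (x : E) : (iteratedFDeriv ℝ k W x fun _ => bSeries q a W x) =
      ∑ f ∈ Fintype.piFinset fun _ : Fin k => RTree.upTo q,
        (∏ i, a (f i) / (f i).symmetry) • elemDiff W x (RTree.node (Finset.univ.val.map f)) := by
  simp only [bSeries]
  rw [ContinuousMultilinearMap.map_sum_finset _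
    (fun _ t => (a t / t.symmetry) • elemDiff W x t) fun _ => RTree.upTo q]
  refine Finset.sum_congr rfl fun f _ => ?_
  rw [ContinuousMultilinearMap.map_smul_univ, elemDiff_node_map_univ hW]

theorem RTree.node_eq_iff {s : Multiset RTree} {t : RTree} : RTree.node s = t ↔ s = t.branches :=
  ⟨fun h => by rw [← h, RTree.branches_node], fun h => by rw [h, RTree.node_branches]⟩

/- All tuples enumerating the branches contribute equally; their number is `k!` divided by the
factorials of the multiplicities, which `σ` contains in addition to the `σ` of the branches. -/
theorem inv_factorial_mul_sum_tuples (a : RTree → ℝ) {t : RTree} {k : ℕ}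
    (hk : t.branches.card = k) {T : Finset (Fin k → RTree)}
    (hT : ∀ f, f ∈ T ↔ Finset.univ.val.map f = t.branches) :
    (k ! : ℝ)⁻¹ * ∑ f ∈ T, ∏ i, a (f i) / (f i).symmetry =
      (t.branches.map a).prod / t.symmetry := by
  classical
  have hterm : ∀ f ∈ T, ∏ i, a (f i) / (f i).symmetry =
      (t.branches.map a).prod / (t.branches.map fun t' => (t'.symmetry : ℝ)).prod := fun f hf => by
    rw [← Multiset.prod_map_div, ← (hT f).1 hf, Multiset.map_map]
    rfl
  have hcount : (T.card : ℝ) * ∏ t' ∈ t.branches.toFinset, ((t.branches.count t')! : ℝ) = k ! := by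
    have hset : {f : Fin k → RTree | Finset.univ.val.map f = t.branches} = T :=
      Set.ext fun f => (hT f).symm
    have h := ncard_tuples_mul_prod_factorial hk
    rw [hset, Set.ncard_coe_finset] at h
    exact_mod_cast h
  have hk0 : (T.card : ℝ) * ∏ t' ∈ t.branches.toFinset, ((t.branches.count t')! : ℝ) ≠ 0 := by
    rw [hcount]
    exact_mod_cast k.factorial_ne_zero
  have hsymm : (t.symmetry : ℝ) = (∏ t' ∈ t.branches.toFinset, ((t.branches.count t')! : ℝ)) *
      (t.branches.map fun t' => (t'.symmetry : ℝ)).prod := by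
    rw [t.symmetry_eq]
    push_cast
    rw [Multiset.map_map]
    rfl
  rw [Finset.sum_congr rfl hterm, Finset.sum_const, nsmul_eq_mul, ← hcount, hsymm]
  have hT0 := left_ne_zero_of_mul hk0
  have hP0 := right_ne_zero_of_mul hk0
  field_simp

theorem sum_tuples_eq_sum_branches {k q : ℕ} (a : RTree → ℝ) (F : RTree → E) :
    (k ! : ℝ)⁻¹ • ∑ f ∈ Fintype.piFinset fun _ : Fin k => RTree.upTo q with
        (RTree.node (Finset.univ.val.map f)).order ≤ q + 1,
        (∏ i, a (f i) / (f i).symmetry) • F (RTree.node (Finset.univ.val.map f)) =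
      ∑ t ∈ RTree.upTo (q + 1) with t.branches.card = k,
        ((t.branches.map a).prod / t.symmetry) • F t := by
  classical
  have hmaps : ∀ f ∈ (Fintype.piFinset fun _ : Fin k => RTree.upTo q).filter
      (fun f => (RTree.node (Finset.univ.val.map f)).order ≤ q + 1),
      RTree.node (Finset.univ.val.map f) ∈
        (RTree.upTo (q + 1)).filter fun t => t.branches.card = k := fun f hf =>
    Finset.mem_filter.2 ⟨RTree.mem_upTo.2 (Finset.mem_filter.1 hf).2, by
      simp [RTree.branches_node]⟩
  rw [← Finset.sum_fiberwise_of_maps_to hmaps, Finset.smul_sum]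
  refine Finset.sum_congr rfl fun t ht => ?_
  obtain ⟨ht, hk⟩ := Finset.mem_filter.1 ht
  rw [RTree.mem_upTo] at ht
  rw [← inv_factorial_mul_sum_tuples a hk (T := {f ∈ {f ∈ Fintype.piFinset fun _ : Fin k =>
    RTree.upTo q | (RTree.node (Finset.univ.val.map f)).order ≤ q + 1} |
      RTree.node (Finset.univ.val.map f) = t}), mul_smul, Finset.sum_smul]
  · refine congrArg _ (Finset.sum_congr rfl fun f hf => ?_)
    rw [(Finset.mem_filter.1 hf).2]
  intro f
  simp only [Finset.mem_filter, Fintype.mem_piFinset, RTree.mem_upTo, RTree.node_eq_iff]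
  refine ⟨fun h => h.2, fun h => ⟨⟨fun i => ?_, ?_⟩, h⟩⟩
  · have hmem : f i ∈ t.branches := h ▸ Multiset.mem_map_of_mem f (Finset.mem_univ_val i)
    exact Nat.lt_succ_iff.1 ((RTree.order_lt_of_mem_branches hmem).trans_le ht)
  · rwa [RTree.node_eq_iff.2 h]

theorem sum_tuples_eq_bSeries (q : ℕ) (a : RTree → ℝ) (W : E → E) (x : E) :
    ∑ k ∈ Finset.range (q + 1), (k ! : ℝ)⁻¹ •
      ∑ f ∈ Fintype.piFinset fun _ : Fin k => RTree.upTo q with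
        (RTree.node (Finset.univ.val.map f)).order ≤ q + 1,
        (∏ i, a (f i) / (f i).symmetry) • elemDiff W x (RTree.node (Finset.univ.val.map f)) =
      bSeries (q + 1) (fun t => (t.branches.map a).prod) W x := by
  have hmaps : ∀ t ∈ RTree.upTo (q + 1), t.branches.card ∈ Finset.range (q + 1) := fun t ht =>
    Finset.mem_range.2 (t.card_branches_lt_order.trans_le (RTree.mem_upTo.1 ht))
  simp only [sum_tuples_eq_sum_branches]
  exact Finset.sum_fiberwise_of_maps_to hmaps _

end BSeries

/-! ### Error estimates -/

section Estimates

open Asymptotics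

variable {ι : Type*} {l : Filter ι} {E : Type} [NormedAddCommGroup E] [NormedSpace ℝ E]
  {W : ι → E → E} {M : ι → ℝ} {x : ι → E}

theorem isBigO_pow_of_le (hM : M =O[l] fun _ => (1 : ℝ)) {k n : ℕ} (hkn : k ≤ n) :
    (fun i => M i ^ n) =O[l] fun i => M i ^ k := by
  have h := (isBigO_refl (fun i => M i ^ k) l).mul (hM.pow (n - k))
  simpa only [← pow_add, Nat.add_sub_cancel' hkn, one_pow, mul_one] using h

theorem isBigO_sum_smul {κ : Type*} {s : Finset κ} {f : κ → ι → E} {g : ι → ℝ} (c : κ → ℝ)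
    (hf : ∀ k ∈ s, f k =O[l] g) : (fun i => ∑ k ∈ s, c k • f k i) =O[l] g :=
  IsBigO.fun_sum fun k hk => (hf k hk).const_smul_left (c k)

theorem isBigO_elemDiff {n : ℕ} (hW : ∀ i, BoundedDerivs n (W i) (M i)) {t : RTree}
    (ht : t.order ≤ n + 1) :
    (fun i => elemDiff (W i) (x i) t) =O[l] fun i => M i ^ t.order :=
  isBigO_of_le _ fun i => (norm_elemDiff_le (hW i) (x i) ht).trans (le_abs_self _)

theorem isBigO_bSeries (hM : M =O[l] fun _ => (1 : ℝ)) {n q : ℕ}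
    (hW : ∀ i, BoundedDerivs n (W i) (M i)) (hq : q ≤ n + 1) (a : RTree → ℝ) :
    (fun i => bSeries q a (W i) (x i)) =O[l] M := by
  refine isBigO_sum_smul _ fun t ht => ?_
  refine (isBigO_elemDiff hW ((RTree.mem_upTo.1 ht).trans hq)).trans ?_
  simpa only [pow_one] using isBigO_pow_of_le hM t.order_pos

theorem isBigO_elemDiff_tuple {k n q : ℕ} (hM : M =O[l] fun _ => (1 : ℝ))
    (hW : ∀ i, BoundedDerivs n (W i) (M i)) (hk : k ≤ n) {f : Fin k → RTree}
    (hf : ∀ j, (f j).order ≤ n + 1) (hq : q ≤ (RTree.node (Finset.univ.val.map f)).order) :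
    (fun i => elemDiff (W i) (x i) (RTree.node (Finset.univ.val.map f))) =O[l]
      fun i => M i ^ q := by
  refine (isBigO_of_le _ fun i => ?_).trans (isBigO_pow_of_le hM hq)
  refine (norm_elemDiff_node_le (hW i) (by simpa using hk) ?_).trans (le_abs_self _)
  exact Multiset.forall_mem_map_iff.2 fun j _ => norm_elemDiff_le (hW i) _ (hf j)

theorem isBigO_map_add_sub_taylor {n : ℕ} {h : ι → E} (hW : ∀ i, BoundedDerivs n (W i) (M i))
    (hh : h =O[l] M) :
    (fun i => W i (x i + h i) -
      ∑ k ∈ Finset.range n, (k ! : ℝ)⁻¹ • iteratedFDeriv ℝ k (W i) (x i) fun _ => h i) =O[l]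
      fun i => M i ^ (n + 1) := by
  have htaylor := isBigO_of_le (g := fun i => M i * ‖h i‖ ^ n) l fun i =>
    (norm_map_add_sub_taylor_le (hW i) (x i) (h i)).trans (le_abs_self _)
  simpa only [pow_succ'] using htaylor.trans ((isBigO_refl M l).mul (hh.norm_left.pow n))

theorem norm_iteratedFDeriv_diag_sub_le {n k : ℕ} {W : E → E} {M : ℝ} (hW : BoundedDerivs n W M)
    (hk : k ≤ n) (x h p : E) :
    ‖(iteratedFDeriv ℝ k W x fun _ => h) - iteratedFDeriv ℝ k W x fun _ => p‖ ≤
      M * k * (‖h‖ + ‖p‖) ^ (k - 1) * ‖h - p‖ := by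
  refine (ContinuousMultilinearMap.norm_image_sub_le _ _ _).trans ?_
  rw [Fintype.card_fin]
  have hM := hW.nonneg
  gcongr
  · exact hW.norm_iteratedFDeriv_le k hk x
  · exact (max_le_max (pi_norm_const_le h) (pi_norm_const_le p)).trans
      (max_le_add_of_nonneg (norm_nonneg h) (norm_nonneg p))
  · exact pi_norm_const_le (h - p)

theorem isBigO_iteratedFDeriv_diag_sub {n k r : ℕ} {h p : ι → E}
    (hM : M =O[l] fun _ => (1 : ℝ)) (hW : ∀ i, BoundedDerivs n (W i) (M i)) (hk : k ≤ n)
    (hh : h =O[l] M) (hp : p =O[l] M) (hhp : (fun i => h i - p i) =O[l] fun i => M i ^ r) :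
    (fun i => (iteratedFDeriv ℝ k (W i) (x i) fun _ => h i) -
      iteratedFDeriv ℝ k (W i) (x i) fun _ => p i) =O[l] fun i => M i ^ (r + 1) := by
  have hsum : (fun i => (‖h i‖ + ‖p i‖) ^ (k - 1)) =O[l] fun _ => (1 : ℝ) := by
    simpa only [one_pow] using ((hh.trans hM).norm_left.add (hp.trans hM).norm_left).pow (k - 1)
  have hMk : (fun i => M i * k) =O[l] M := by
    simpa only [mul_one] using (isBigO_refl M l).mul (isBigO_const_const (k : ℝ) one_ne_zero l)
  have hprod := (hMk.mul hsum).mul hhp.norm_left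
  simp only [mul_one, ← pow_succ'] at hprod
  exact (isBigO_of_le _ fun i =>
    (norm_iteratedFDeriv_diag_sub_le (hW i) hk _ _ _).trans (le_abs_self _)).trans hprod

theorem isBigO_taylor_bSeries_sub {q : ℕ} (hM : M =O[l] fun _ => (1 : ℝ))
    (hW : ∀ i, BoundedDerivs q (W i) (M i)) (a : RTree → ℝ) :
    (fun i => ∑ k ∈ Finset.range (q + 1),
        (k ! : ℝ)⁻¹ • (iteratedFDeriv ℝ k (W i) (x i) fun _ => bSeries q a (W i) (x i)) -
      bSeries (q + 1) (fun t => (t.branches.map a).prod) (W i) (x i)) =O[l]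
      fun i => M i ^ (q + 2) := by
  have htail (i : ι) (k : ℕ) (hk : k ∈ Finset.range (q + 1)) :
      (iteratedFDeriv ℝ k (W i) (x i) fun _ => bSeries q a (W i) (x i)) = _ :=
    (iteratedFDeriv_bSeries ((hW i).mono (Finset.mem_range_succ_iff.1 hk)).contDiff q a
      (x i)).trans (Finset.sum_filter_add_sum_filter_not _
        (fun f => (RTree.node (Finset.univ.val.map f)).order ≤ q + 1) _).symm
  simp only [Finset.sum_congr rfl fun k hk => congrArg _ (htail _ k hk), smul_add,
    Finset.sum_add_distrib, sum_tuples_eq_bSeries, add_sub_cancel_left]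
  refine isBigO_sum_smul _ fun k hk => isBigO_sum_smul _ fun f hf => ?_
  obtain ⟨hf, hlarge⟩ := Finset.mem_filter.1 hf
  have horder (j : Fin k) : (f j).order ≤ q := RTree.mem_upTo.1 (Fintype.mem_piFinset.1 hf j)
  exact isBigO_elemDiff_tuple hM hW (Finset.mem_range_succ_iff.1 hk)
    (fun j => (horder j).trans q.le_succ) (not_le.1 hlarge)

theorem isBigO_map_add_sub_bSeries {q : ℕ} {h : ι → E} {a : RTree → ℝ}
    (hM : M =O[l] fun _ => (1 : ℝ)) (hW : ∀ i, BoundedDerivs (q + 1) (W i) (M i))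
    (hh : (fun i => h i - bSeries q a (W i) (x i)) =O[l] fun i => M i ^ (q + 1)) :
    (fun i => W i (x i + h i) -
      bSeries (q + 1) (fun t => (t.branches.map a).prod) (W i) (x i)) =O[l]
      fun i => M i ^ (q + 2) := by
  have hp : (fun i => bSeries q a (W i) (x i)) =O[l] M :=
    isBigO_bSeries hM hW (by omega) a
  have hhM : h =O[l] M := by
    have hdiff := hh.trans (isBigO_pow_of_le hM q.succ_pos)
    simp only [Nat.succ_eq_add_one, zero_add, pow_one] at hdiff
    exact (hdiff.add hp).congr_left fun i => sub_add_cancel _ _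
  have htaylor := isBigO_map_add_sub_taylor (x := x) hW hhM
  have hdiag : (fun i => ∑ k ∈ Finset.range (q + 1),
      (k ! : ℝ)⁻¹ • ((iteratedFDeriv ℝ k (W i) (x i) fun _ => h i) -
        iteratedFDeriv ℝ k (W i) (x i) fun _ => bSeries q a (W i) (x i))) =O[l]
      fun i => M i ^ (q + 2) :=
    isBigO_sum_smul _ fun k hk =>
      isBigO_iteratedFDeriv_diag_sub hM hW (Finset.mem_range.1 hk).le hhM hp hh
  have hseries := isBigO_taylor_bSeries_sub (x := x) hM (fun i => (hW i).mono q.le_succ) a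
  refine ((htaylor.add hdiag).add hseries).congr_left fun i => ?_
  simp only [smul_sub, Finset.sum_sub_distrib]
  abel

end Estimates

/-! ### Runge–Kutta methods -/

section RungeKutta

open Asymptotics

variable {E : Type} [NormedAddCommGroup E] [NormedSpace ℝ E] {K : ℕ}
  {A : Matrix (Fin K) (Fin K) ℝ}

/-- The stage equations of the Runge–Kutta method with matrix `A` and step `1`, started at `x`. -/
def IsStages (A : Matrix (Fin K) (Fin K) ℝ) (W : E → E) (x : E) (Y : Fin K → E) : Prop :=
  ∀ i, Y i = x + ∑ j, A i j • W (Y j)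

/-- `y` is the result of one step, of size `1`, of the Runge–Kutta method `(A, b)` for a vector
field on an arbitrary normed space. -/
def IsRungeKuttaStep (A : Matrix (Fin K) (Fin K) ℝ) (b : Fin K → ℝ) (W : E → E) (x y : E) :
    Prop :=
  ∃ Y, IsStages A W x Y ∧ y = x + ∑ i, b i • W (Y i)

theorem IsStages.sub_sub_bSeries_eq {W : E → E} {x : E} {Y : Fin K → E} (hY : IsStages A W x Y)
    (q : ℕ) (i : Fin K) :
    Y i - x - bSeries q (fun t => t.weight A i) W x =
      ∑ j, A i j • (W (Y j) -
        bSeries q (fun t => (t.branches.map fun t' => t'.weight A j).prod) W x) := by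
  simp only [fun t : RTree => t.weight_eq A i]
  rw [bSeries_sum]
  conv_lhs => rw [hY i]
  simp only [smul_sub, Finset.sum_sub_distrib, add_sub_cancel_left]

theorem sum_smul_bSeries_of_orderConditions {m : ℕ} {b : Fin K → ℝ} (hAb : OrderConditions m A b)
    (W : E → E) (x : E) :
    ∑ i, b i • bSeries m (fun t => (t.branches.map fun t' => t'.weight A i).prod) W x =
      ∑ t ∈ RTree.upTo m, (t.labellings / t.order ! : ℝ) • elemDiff W x t := by
  rw [← bSeries_sum]
  exact Finset.sum_congr rfl fun t ht => by rw [hAb t (RTree.mem_upTo.1 ht)]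

variable {ι : Type*} {l : Filter ι} {W : ι → E → E} {M : ι → ℝ} {x : ι → E} {Y : ι → Fin K → E}

theorem isBigO_stage_sub_bSeries (hM : M =O[l] fun _ => (1 : ℝ)) {q : ℕ}
    (hW : ∀ i, BoundedDerivs q (W i) (M i)) (hY : ∀ i, IsStages A (W i) (x i) (Y i)) (j : Fin K) :
    (fun i => W i (Y i j) -
      bSeries q (fun t => (t.branches.map fun t' => t'.weight A j).prod) (W i) (x i)) =O[l]
      fun i => M i ^ (q + 1) := by
  induction q generalizing j with
  | zero =>
    simp only [bSeries_zero, sub_zero, zero_add, pow_one]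
    exact isBigO_of_le _ fun i => ((hW i).norm_le _).trans (le_abs_self _)
  | succ q ih =>
    have hstage : (fun i => Y i j - x i - bSeries q (fun t => t.weight A j) (W i) (x i)) =O[l]
        fun i => M i ^ (q + 1) := by
      simp only [fun i => (hY i).sub_sub_bSeries_eq q j]
      exact isBigO_sum_smul _ fun k _ => ih (fun i => (hW i).mono q.le_succ) k
    simpa only [add_sub_cancel] using isBigO_map_add_sub_bSeries hM hW hstage

theorem isBigO_rungeKutta_sub_flow {m : ℕ} {b : Fin K → ℝ} (hAb : OrderConditions m A b)
    (hM : M =O[l] fun _ => (1 : ℝ)) (hW : ∀ i, BoundedDerivs m (W i) (M i))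
    {z : ι → ℝ → E} (hz₀ : ∀ i, z i 0 = x i)
    (hz : ∀ i, ∀ t ∈ Set.Icc (0 : ℝ) 1, HasDerivWithinAt (z i) (W i (z i t)) (Set.Icc 0 1) t)
    (hY : ∀ i, IsStages A (W i) (x i) (Y i)) :
    (fun i => x i + ∑ j, b j • W i (Y i j) - z i 1) =O[l] fun i => M i ^ (m + 1) := by
  have hstages : (fun i => ∑ j, b j • (W i (Y i j) -
      bSeries m (fun t => (t.branches.map fun t' => t'.weight A j).prod) (W i) (x i))) =O[l]
      fun i => M i ^ (m + 1) :=
    isBigO_sum_smul b fun j _ => isBigO_stage_sub_bSeries hM hW hY j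
  have hflow : (fun i => z i 1 - (x i + ∑ t ∈ RTree.upTo m,
      (t.labellings / t.order ! : ℝ) • elemDiff (W i) (x i) t)) =O[l] fun i => M i ^ (m + 1) :=
    IsBigO.of_bound _ (.of_forall fun i => by
      rw [norm_pow, Real.norm_of_nonneg (hW i).nonneg, ← hz₀ i]
      exact norm_flow_sub_le (hW i) (hz i))
  refine (hstages.sub hflow).congr_left fun i => ?_
  simp only [smul_sub, Finset.sum_sub_distrib, sum_smul_bSeries_of_orderConditions hAb]
  abel

theorem norm_rungeKutta_sub_flow_le {b : Fin K → ℝ} {W : E → E} {M : ℝ} {m : ℕ}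
    (hW : BoundedDerivs m W M) {z : ℝ → E}
    (hz : ∀ t ∈ Set.Icc (0 : ℝ) 1, HasDerivWithinAt z (W (z t)) (Set.Icc 0 1) t) (Y : Fin K → E) :
    ‖z 0 + ∑ i, b i • W (Y i) - z 1‖ ≤ (∑ i, |b i| + 1) * M := by
  have hstep : ‖∑ i, b i • W (Y i)‖ ≤ (∑ i, |b i|) * M := by
    rw [Finset.sum_mul]
    refine norm_sum_le_of_le _ fun i _ => ?_
    rw [norm_smul, Real.norm_eq_abs]
    exact mul_le_mul_of_nonneg_left (hW.norm_le _) (abs_nonneg _)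
  have hflow : ‖z 1 - z 0‖ ≤ M := by
    simpa using (convex_Icc (0 : ℝ) 1).norm_image_sub_le_of_norm_hasDerivWithin_le hz
      (fun t _ => hW.norm_le (z t)) (Set.left_mem_Icc.2 zero_le_one)
      (Set.right_mem_Icc.2 zero_le_one)
  calc ‖z 0 + ∑ i, b i • W (Y i) - z 1‖ = ‖∑ i, b i • W (Y i) - (z 1 - z 0)‖ := by
        congr 1
        abel
    _ ≤ (∑ i, |b i|) * M + M := norm_sub_le_of_le hstep hflow
    _ = (∑ i, |b i| + 1) * M := by ring

variable (E A) in
/-- All the data to which a uniform bound on the error of one step refers: a vector field whose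
derivatives are bounded by `M ≤ 1`, one of its integral curves, and the stages of a Runge–Kutta step
with the same initial point. -/
structure StepData (m : ℕ) where
  field : E → E
  M : ℝ
  curve : ℝ → E
  stages : Fin K → E
  le_one : M ≤ 1
  boundedDerivs : BoundedDerivs m field M
  hasDerivWithinAt : ∀ t ∈ Set.Icc (0 : ℝ) 1,
    HasDerivWithinAt curve (field (curve t)) (Set.Icc 0 1) t
  isStages : IsStages A field (curve 0) stages

/- Along the filter `⊤` on the type of all data, `O` means a uniform bound. -/
theorem exists_norm_rungeKutta_sub_flow_le {m : ℕ} {b : Fin K → ℝ} (hAb : OrderConditions m A b) :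
    ∃ C : ℝ, ∀ d : StepData E A m,
      ‖d.curve 0 + ∑ i, b i • d.field (d.stages i) - d.curve 1‖ ≤ C * d.M ^ (m + 1) := by
  have hM : (fun d : StepData E A m => d.M) =O[⊤] fun _ => (1 : ℝ) := isBigO_of_le _ fun d => by
    rw [Real.norm_of_nonneg d.boundedDerivs.nonneg, norm_one]
    exact d.le_one
  obtain ⟨C, hC⟩ := isBigO_top.1 <| isBigO_rungeKutta_sub_flow hAb hM
    (fun d => d.boundedDerivs) (fun _ => rfl) (fun d => d.hasDerivWithinAt) fun d => d.isStages
  refine ⟨C, fun d => (hC d).trans_eq ?_⟩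
  rw [norm_pow, Real.norm_of_nonneg d.boundedDerivs.nonneg]

end RungeKutta

/-! ### The `C^n` norm -/

namespace SmoothBdd

variable {N : ℕ} (W : SmoothBdd N)

theorem derivNorm_nonneg (n : ℕ) : 0 ≤ W.derivNorm n := by
  refine Real.sSup_nonneg ?_
  rintro _ ⟨x, U, -, rfl⟩
  exact norm_nonneg _

theorem norm_iteratedFDeriv_apply_le_derivNorm {n : ℕ} (x : EuclideanSpace ℝ (Fin N))
    {U : Fin n → EuclideanSpace ℝ (Fin N)} (hU : ∀ i, ‖U i‖ = 1) :
    ‖iteratedFDeriv ℝ n W x U‖ ≤ W.derivNorm n := by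
  obtain ⟨C, hC⟩ := W.bounded n
  refine le_csSup ⟨C, ?_⟩ ⟨x, U, hU, rfl⟩
  rintro _ ⟨y, V, hV, rfl⟩
  refine (ContinuousMultilinearMap.le_opNorm _ _).trans ?_
  simpa only [hV, Finset.prod_const_one, mul_one] using hC y

theorem norm_iteratedFDeriv_le_derivNorm (n : ℕ) (x : EuclideanSpace ℝ (Fin N)) :
    ‖iteratedFDeriv ℝ n W x‖ ≤ W.derivNorm n := by
  refine ContinuousMultilinearMap.opNorm_le_bound (W.derivNorm_nonneg n) fun U => ?_
  by_cases hzero : ∃ i, U i = 0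
  · obtain ⟨i, hi⟩ := hzero
    rw [ContinuousMultilinearMap.map_coord_zero _ i hi, norm_zero]
    exact mul_nonneg (W.derivNorm_nonneg n) (Finset.prod_nonneg fun _ _ => norm_nonneg _)
  · push Not at hzero
    have hU : U = fun i => ‖U i‖ • (‖U i‖⁻¹ • U i) := funext fun i => by
      rw [smul_inv_smul₀ (norm_ne_zero_iff.2 (hzero i))]
    conv_lhs => rw [hU, ContinuousMultilinearMap.map_smul_univ]
    rw [norm_smul, mul_comm, norm_prod]
    simp only [norm_norm]
    gcongr
    refine W.norm_iteratedFDeriv_apply_le_derivNorm x fun i => ?_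
    rw [norm_smul, norm_inv, norm_norm, inv_mul_cancel₀ (norm_ne_zero_iff.2 (hzero i))]

theorem boundedDerivs_cNorm (n : ℕ) : BoundedDerivs n W (W.cNorm n) where
  contDiff := W.contDiff.of_le (by exact_mod_cast le_top)
  norm_iteratedFDeriv_le k hk x := (W.norm_iteratedFDeriv_le_derivNorm k x).trans <|
    Finset.single_le_sum (f := W.derivNorm) (fun i _ => W.derivNorm_nonneg i)
      (Finset.mem_range_succ_iff.2 hk)

end SmoothBdd

theorem IsRungeKuttaValue.isRungeKuttaStep {N K : ℕ} {A : Matrix (Fin K) (Fin K) ℝ}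
    {b : Fin K → ℝ} {W : SmoothBdd N}
    {x y : EuclideanSpace ℝ (Fin N)} (h : IsRungeKuttaValue A b W 1 x y) :
    IsRungeKuttaStep A b W x y := by
  simpa only [IsRungeKuttaValue, IsRungeKuttaStep, IsStages, one_smul] using h

end RK

end

theorem theorem4_general {E : Type} [NormedAddCommGroup E] [NormedSpace ℝ E] {m K : ℕ}
    {A : Matrix (Fin K) (Fin K) ℝ} {b : Fin K → ℝ} (hAb : RK.OrderConditions m A b) :
    ∃ C : ℝ, 0 < C ∧ ∀ (W : E → E) (M : ℝ) (z : ℝ → E) (y : E), RK.BoundedDerivs m W M →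
      (∀ t ∈ Set.Icc (0 : ℝ) 1, HasDerivWithinAt z (W (z t)) (Set.Icc 0 1) t) →
      RK.IsRungeKuttaStep A b W (z 0) y → ‖y - z 1‖ ≤ C * M ^ (m + 1) := by
  obtain ⟨C, hC⟩ := RK.exists_norm_rungeKutta_sub_flow_le (E := E) hAb
  refine ⟨max C (∑ i, |b i| + 1), lt_max_of_lt_right (by positivity), ?_⟩
  rintro W M z _ hW hz ⟨Y, hY, rfl⟩
  have hM := hW.nonneg
  rcases le_total M 1 with hM1 | hM1
  · refine (hC ⟨W, M, z, Y, hM1, hW, hz, hY⟩).trans ?_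
    gcongr
    exact le_max_left _ _
  · refine (RK.norm_rungeKutta_sub_flow_le hW hz Y).trans ?_
    gcongr
    exacts [le_max_right _ _, le_self_pow₀ hM1 m.succ_ne_zero]

theorem theorem4 {N K : ℕ} (m : ℕ) (A : Matrix (Fin K) (Fin K) ℝ) (b : Fin K → ℝ)
    (hAb : RK.OrderConditions m A b)
    (g : RK.SmoothBdd N → EuclideanSpace ℝ (Fin N) → EuclideanSpace ℝ (Fin N))
    (hg : ∀ (W : RK.SmoothBdd N) (y₀ : EuclideanSpace ℝ (Fin N)),
      RK.IsRungeKuttaValue A b W 1 y₀ (g W y₀)) :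
    RK.IsIntegrationScheme m g := by
  obtain ⟨C, hC, hbound⟩ := theorem4_general (E := EuclideanSpace ℝ (Fin N)) hAb
  exact ⟨C, hC, fun W x => have hz := (W.exists_solution x).choose_spec;
    hbound W _ _ _ ((W.boundedDerivs_cNorm (m + 1)).mono m.le_succ) hz.2
      (hz.1.symm ▸ (hg W x).isRungeKuttaStep)⟩
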